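/- Let $\mathbf X=(X,d,D,\alpha)$ be a computable complete metric space: $(X,d)$ is a complete metric space and $\alpha:\mathbb N\to X$ enumerates a dense set $D$ such that the distances $d(\alpha(i),\alpha(j))$ are computable reals uniformly in $i,j$. The canonical basis of $X$ consists of the balls with center in $D$ and positive rational radius. Let $\mathcal M(\mathbf X)$ be the space of Borel probability measures on $X$ with the weak topology. Its canonical basis consists of the finite intersections of sets $\{\mu:\int f\,d\mu<r\}$ and $\{\mu:\int f\,d\mu>r\}$, where $r\in\mathbb Q$ and $f$ is the maximum of finitely many hat functions $g_{u,q,1/n}(x)=|1-n\,|d(x,u)-q|^+|^+$ with $u\in D$, $q\in\mathbb Q$, $n\ge 1$. The canonical basis of $X\times\mathcal M(\mathbf X)$ consists of the products of canonical basis sets. A function $f:S\to[0,\infty]$ on a subset $S$ of one of these spaces is *lower semicomputable* if the sets $\{y\in S: f(y)>q\}$, $q\in\mathbb Q_{\ge0}$, are, uniformly in $q$, traces on $S$ of unions of recursively enumerable families of canonical basis sets. A set $\mathcal C\subseteq\mathcal M(\mathbf X)$ is *effectively compact* if it is compact and the set of those finite families of canonical basis sets that cover $\mathcal C$ is recursively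 enumerable. For $\mu\in\mathcal M(\mathbf X)$, a *$\mu$-test* is a function $f:X\to[0,\infty]$ that is $\mu$-lower semicomputable (that is, lower semicomputable as a function on $X\times\{\mu\}$) with $\int f\,d\mu\le 1$. A *uniform test* is a lower semicomputable function $(x,\mu)\mapsto f_\mu(x)$ on $X\times\mathcal M(\mathbf X)$ such that $f_\mu$ is a $\mu$-test for every $\mu$. For an effectively compact $\mathcal C$, a *$\mathcal C$-test* is a lower semicomputable function $f:X\to[0,\infty]$ with $\int f\,d\mu\le1$ for all $\mu\in\mathcal C$. A uniform test (respectively, a $\mathcal C$-test) is *universal* if it dominates every other uniform test (respectively, $\mathcal C$-test) up to a positive multiplicative constant. A *separating test* for $\mathcal C$ is a lower semicomputable function $(x,\mu)\mapsto s_\mu(x)\in[0,\infty]$ on $X\times\mathcal C$ such that $s_\mu$ is a $\mu$-test for each $\mu\in\mathcal C$, and $\max(s_\mu(x),s_\nu(x))=\infty$ for all $x\in X$ whenever $\mu\ne\nu$ are in $\mathcal C$. **Theorem.** Let $\mathcal C\subseteq\mathcal M(\mathbf X)$ be an effectively compact class of measures, let $t_\mu(x)$ be a universal uniform test, let $t_{\mathcal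 C}(x)$ be a universal $\mathcal C$-test, and let $s_\mu(x)$ be a separating test for $\mathcal C$. Then there is a constant $c>0$ such that for all $\mu\in\mathcal C$ and all $x\in X$, $$ t_\mu(x)\le c\,\max\bigl(t_{\mathcal C}(x),s_\mu(x)\bigr)\qquad\text{and}\qquad \max\bigl(t_{\mathcal C}(x),s_\mu(x)\bigr)\le c\,t_\mu(x). $$ In particular, for $\mu\in\mathcal C$ and $x\in X$, the point $x$ is random with respect to $\mu$ (that is, $t_\mu(x)<\infty$) if and only if $t_{\mathcal C}(x)<\infty$ and $s_\mu(x)<\infty$ ($x$ is typical for $\mu$). -/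

import Mathlib

open MeasureTheory Set
open scoped ENNReal NNReal

noncomputable section

namespace AlgRandom

/-! Rational numbers are handled through codes by natural numbers, so that the recursion theory
applies to them directly. -/

/-- The rational number `(a - b) / (c + 1)` coded by `(a, b, c)`; every rational has a code. -/
def ratOf (q : ℕ × ℕ × ℕ) : ℝ := ((q.1 : ℝ) - (q.2.1 : ℝ)) / ((q.2.2 : ℝ) + 1)

/-- The nonnegative rational number `a / (b + 1)` coded by `(a, b)`. -/
def nnratOf (q : ℕ × ℕ) : ℝ≥0 := (q.1 : ℝ≥0) / ((q.2 : ℝ≥0) + 1)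

/-- The positive rational number `(a + 1) / (b + 1)` coded by `(a, b)`. -/
def posRatOf (q : ℕ × ℕ) : ℝ := ((q.1 : ℝ) + 1) / ((q.2 : ℝ) + 1)

/-- A computable structure on a metric space `X`: an enumeration `α` (repetitions allowed) of a
dense set such that the distances `d (α i) (α j)` are computable uniformly in `i` and `j`. A
computable complete metric space is a complete metric space with such a structure. -/
structure ComputableMetric (X : Type*) [MetricSpace X] where
  α : ℕ → X
  dense : DenseRange α
  computable_dist : ∃ g : ℕ × ℕ × ℕ → ℕ × ℕ × ℕ, Computable g ∧
    ∀ i j n : ℕ, |dist (α i) (α j) - ratOf (g (i, j, n))| ≤ 1 / ((n : ℝ) + 1)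

section Effective

/-! An effective topology on `Y` is given by a family `B` of canonical basis sets, indexed by a type
`ι` of finite objects. -/

variable {ι κ Y Z : Type*} [Primcodable ι] [Primcodable κ]

/-- The canonical basis of a product: products of canonical basis sets. -/
def prodBasis (B : ι → Set Y) (B' : κ → Set Z) : ι × κ → Set (Y × Z) :=
  fun i => B i.1 ×ˢ B' i.2

/-- `f` is lower semicomputable on the subspace `S`: the sets `{y ∈ S | q < f y}` for rational `q`
are, uniformly in `q`, traces on `S` of unions of recursively enumerable families of canonical basis
sets. The values of `f` outside `S` play no role. -/
def LowerSemicomputableOn (B : ι → Set Y) (S : Set Y) (f : Y → ℝ≥0∞) : Prop :=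
  ∃ W : ι × (ℕ × ℕ) → Prop, REPred W ∧
    ∀ y ∈ S, ∀ q : ℕ × ℕ, (nnratOf q : ℝ≥0∞) < f y ↔ ∃ i : ι, W (i, q) ∧ y ∈ B i

/-- Lower semicomputability on the whole space. -/
def LowerSemicomputable (B : ι → Set Y) (f : Y → ℝ≥0∞) : Prop :=
  LowerSemicomputableOn B univ f

/-- `C` is effectively compact: it is compact, and the finite families of canonical basis sets that
cover `C` form a recursively enumerable set. -/
def EffectivelyCompact [TopologicalSpace Y] (B : ι → Set Y) (C : Set Y) : Prop :=
  IsCompact C ∧ REPred (fun L : List ι => C ⊆ ⋃ i ∈ L, B i)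

end Effective

section Bases

variable {X : Type*} [MetricSpace X]

/-- The canonical balls: the open balls whose center is a point of the enumerated dense set and
whose radius is a positive rational. -/
def ComputableMetric.ball (𝒳 : ComputableMetric X) : ℕ × (ℕ × ℕ) → Set X :=
  fun c => Metric.ball (𝒳.α c.1) (posRatOf c.2)

/-- The hat function `x ↦ |1 - |d(x, u) - r|⁺ / ε|⁺`. -/
def hat (u : X) (r ε : ℝ) : X → ℝ :=
  fun x => max (1 - max (dist x u - r) 0 / ε) 0

/-- Code of a hat function: the index of its center, a code of the rational `r`, and `n` for
`ε = 1 / (n + 1)`. -/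
abbrev HatCode : Type := ℕ × (ℕ × ℕ × ℕ) × ℕ

/-- The hat function with a given code. -/
def ComputableMetric.hatOf (𝒳 : ComputableMetric X) (c : HatCode) : X → ℝ :=
  hat (𝒳.α c.1) (ratOf c.2.1) (1 / ((c.2.2 : ℝ) + 1))

/-- The maximum of finitely many hat functions. The empty maximum is the zero function, which is
itself a hat function (with `r = -1` and `ε = 1`). -/
def ComputableMetric.maxHat (𝒳 : ComputableMetric X) (L : List HatCode) : X → ℝ :=
  fun x => (L.map (fun c => 𝒳.hatOf c x)).foldr max 0

variable [MeasurableSpace X]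

/-- The subbasis of the space of probability measures: the sets `{μ | μ f > r}` (for `true`) and
`{μ | μ f < r}` (for `false`), where `f` is a finite maximum of hat functions and `r` is rational. -/
def ComputableMetric.measSubbasis (𝒳 : ComputableMetric X) :
    Bool × List HatCode × (ℕ × ℕ × ℕ) → Set (ProbabilityMeasure X)
  | (true, L, q) => {μ | ratOf q < ∫ x, 𝒳.maxHat L x ∂(μ : Measure X)}
  | (false, L, q) => {μ | ∫ x, 𝒳.maxHat L x ∂(μ : Measure X) < ratOf q}

/-- The canonical basis of the space of probability measures: the finite intersections of sets of
the subbasis. -/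
def ComputableMetric.measBasis (𝒳 : ComputableMetric X) :
    List (Bool × List HatCode × (ℕ × ℕ × ℕ)) → Set (ProbabilityMeasure X) :=
  fun L => {μ | ∀ c ∈ L, μ ∈ 𝒳.measSubbasis c}

end Bases

section Tests

variable {X : Type*} [MetricSpace X] [MeasurableSpace X]

/-- Lower semicomputability, on the set `S` of pairs `(x, μ)`, of a function `(x, μ) ↦ f_μ(x)`. -/
def JointlyLSCOn (𝒳 : ComputableMetric X) (S : Set (X × ProbabilityMeasure X))
    (f : ProbabilityMeasure X → X → ℝ≥0∞) : Prop :=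
  LowerSemicomputableOn (prodBasis 𝒳.ball 𝒳.measBasis) S (fun p => f p.2 p.1)

/-- A `μ`-test: a `μ`-lower semicomputable function `f ≥ 0` with `μ f ≤ 1`. Here
`μ`-lower semicomputable means lower semicomputable in the pair `(x, μ)` for the fixed `μ`. -/
def IsMeasureTest (𝒳 : ComputableMetric X) (μ : ProbabilityMeasure X) (f : X → ℝ≥0∞) : Prop :=
  JointlyLSCOn 𝒳 (univ ×ˢ {μ}) (fun _ => f) ∧ ∫⁻ x, f x ∂(μ : Measure X) ≤ 1

/-- A uniform test: a lower semicomputable function of `(x, μ)` that is a `μ`-test for each `μ`. -/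
def IsUniformTest (𝒳 : ComputableMetric X) (f : ProbabilityMeasure X → X → ℝ≥0∞) : Prop :=
  JointlyLSCOn 𝒳 univ f ∧ ∀ μ, IsMeasureTest 𝒳 μ (f μ)

/-- A uniform test that dominates every uniform test up to a multiplicative constant. -/
def IsUniversalUniformTest (𝒳 : ComputableMetric X)
    (t : ProbabilityMeasure X → X → ℝ≥0∞) : Prop :=
  IsUniformTest 𝒳 t ∧
    ∀ f, IsUniformTest 𝒳 f → ∃ c : ℝ≥0, 0 < c ∧ ∀ μ x, f μ x ≤ c * t μ x

/-- A `C`-test: a lower semicomputable function `f` on `X` with `μ f ≤ 1` for all `μ ∈ C`. -/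
def IsClassTest (𝒳 : ComputableMetric X) (C : Set (ProbabilityMeasure X)) (f : X → ℝ≥0∞) : Prop :=
  LowerSemicomputable 𝒳.ball f ∧ ∀ μ ∈ C, ∫⁻ x, f x ∂(μ : Measure X) ≤ 1

/-- A `C`-test that dominates every `C`-test up to a multiplicative constant. -/
def IsUniversalClassTest (𝒳 : ComputableMetric X) (C : Set (ProbabilityMeasure X))
    (t : X → ℝ≥0∞) : Prop :=
  IsClassTest 𝒳 C t ∧ ∀ f, IsClassTest 𝒳 C f → ∃ c : ℝ≥0, 0 < c ∧ ∀ x, f x ≤ c * t x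

/-- A separating test for `C`: a function `s_μ(x)`, lower semicomputable on `X × C`, such that
`s_μ` is a `μ`-test for each `μ ∈ C`, and `s_μ(x) ∨ s_ν(x) = ∞` for all `x` whenever `μ ≠ ν`
in `C`. Only the values for `μ ∈ C` matter. -/
def IsSeparatingTest (𝒳 : ComputableMetric X) (C : Set (ProbabilityMeasure X))
    (s : ProbabilityMeasure X → X → ℝ≥0∞) : Prop :=
  JointlyLSCOn 𝒳 (univ ×ˢ C) s ∧ (∀ μ ∈ C, IsMeasureTest 𝒳 μ (s μ)) ∧
    ∀ μ ∈ C, ∀ ν ∈ C, μ ≠ ν → ∀ x, max (s μ x) (s ν x) = ∞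

end Tests

end AlgRandom

end

/-! ### Computable functions and recursively enumerable predicates -/

/-! Both inequalities come from universality, once the right auxiliary tests are built.

For `max (tC x) (s μ x) ≤ c * t μ x`: half of the maximum is lower semicomputable on `X × C` and has
integral at most 1 for every `μ ∈ C`, but nothing is known off `C`, where a uniform test must also
behave. Trimming (`exists_isUniformTest_forall_le`) repairs this. Let `E` enumerate pairs of a basis
set and a level `k` such that, over `C`, the function exceeds `2 ^ k` on the basis set. Balls are
replaced by hat functions inside them, so that integrals are continuous in `μ`, and the level `2 ^
k` is granted at `(x, μ)` only after the weighted integral of a whole finite stage has been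
certified to be less than 3 at `μ`. The certificate must be an open condition on `μ`. For this, a
basis set of measures counts as active at `μ` under a closed condition lying between a shrunken set
and the original one: its failure is open, so near `μ` the active list can only lose members and the
bound persists. The granted levels then have integral at most 3 at every `μ`, while on `C` every
stage has integral at most 2 and nothing is lost beyond constants.

For `t μ x ≤ c * max (tC x) (s μ x)`: the infimum over `ν ∈ C` of `max (t ν x) (s ν x) / 2` is a
`C`-test. Its lower semicomputability is where effective compactness enters
(`lowerSemicomputable_iInf`). If `s μ x` is finite, separation makes every other term infinite, so
the infimum is the term of `μ` and is dominated by `tC x`. If `s μ x` is infinite there is nothing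
to prove. -/

namespace Computable

attribute [fun_prop] Computable Computable.id Computable.const Computable.comp Computable.fst
  Computable.snd Computable.pair

variable {α β : Type*} [Primcodable α] [Primcodable β]

@[fun_prop]
theorem fst' {γ : Type*} [Primcodable γ] {f : α → β × γ} (hf : Computable f) :
    Computable fun a => (f a).1 := Computable.fst.comp hf

@[fun_prop]
theorem snd' {γ : Type*} [Primcodable γ] {f : α → β × γ} (hf : Computable f) :
    Computable fun a => (f a).2 := Computable.snd.comp hf

@[fun_prop]
theorem natAdd {f g : α → ℕ} (hf : Computable f) (hg : Computable g) :
    Computable fun a => f a + g a := Primrec.nat_add.to_comp.comp hf hg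

@[fun_prop]
theorem natMul {f g : α → ℕ} (hf : Computable f) (hg : Computable g) :
    Computable fun a => f a * g a := Primrec.nat_mul.to_comp.comp hf hg

@[fun_prop]
theorem natPow {f g : α → ℕ} (hf : Computable f) (hg : Computable g) :
    Computable fun a => f a ^ g a := by
  have : Primrec₂ fun a n : ℕ => a ^ n := by
    refine (Primrec.nat_rec' (f := fun p : ℕ × ℕ => p.2) (g := fun _ => 1)
      (h := fun p q => q.2 * p.1) .snd (.const 1) ?_).of_eq ?_
    · exact Primrec.nat_mul.comp (Primrec.snd.comp .snd) (Primrec.fst.comp .fst)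
    · rintro ⟨a, n⟩
      induction n with
      | zero => rfl
      | succ n ih => simp only [pow_succ, ← ih]
  exact this.to_comp.comp hf hg

@[fun_prop]
theorem boolNot {f : α → Bool} (hf : Computable f) : Computable fun a => !(f a) :=
  Primrec.not.to_comp.comp hf

@[fun_prop]
theorem listRange {f : α → ℕ} (hf : Computable f) : Computable fun a => List.range (f a) :=
  Primrec.list_range.to_comp.comp hf

end Computable

/-! ### Closure properties of recursively enumerable predicates. -/

namespace REPred

variable {α β : Type*} [Primcodable α] [Primcodable β]

/-- A recursively enumerable predicate is the projection of a primitive recursive one, which can be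
taken monotone. -/
theorem exists_primrecPred {p : α → Prop} (hp : REPred p) :
    ∃ R : α × ℕ → Prop, PrimrecPred R ∧ (∀ a m n, m ≤ n → R (a, m) → R (a, n)) ∧
      ∀ a, p a ↔ ∃ m, R (a, m) := by
  obtain ⟨c, hc⟩ := Nat.Partrec.Code.exists_code.1 hp
  refine ⟨fun x => (Nat.Partrec.Code.evaln x.2 c (Encodable.encode x.1)).isSome, ?_, ?_, ?_⟩
  · have h : Primrec fun x : α × ℕ => Nat.Partrec.Code.evaln x.2 c (Encodable.encode x.1) :=
      Nat.Partrec.Code.primrec_evaln.comp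
        (((Primrec.snd).pair (.const c)).pair (Primrec.encode.comp .fst))
    exact Primrec.primrecPred (by simpa using Primrec.option_isSome.comp h)
  · intro a m n hmn h
    obtain ⟨x, hx⟩ := Option.isSome_iff_exists.1 h
    exact Option.isSome_iff_exists.2 ⟨x, Nat.Partrec.Code.evaln_mono hmn hx⟩
  · intro a
    have h : p a ↔ (Nat.Partrec.Code.eval c (Encodable.encode a)).Dom := by
      rw [hc]; simp [Part.assert, Part.bind]
    rw [h, Part.dom_iff_mem]
    simp only [Nat.Partrec.Code.evaln_complete, Option.isSome_iff_exists, Option.mem_def]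
    exact exists_comm

theorem exists_nat {R : α × ℕ → Prop} (hR : ComputablePred R) : REPred fun a => ∃ n, R (a, n) := by
  obtain ⟨f, hf, rfl⟩ := ComputablePred.computable_iff.1 hR
  have h : Partrec fun a => Nat.rfind fun n => Part.some (f (a, n)) :=
    Partrec.rfind (hf.partrec)
  exact h.dom_re.of_eq fun a => by
    refine Nat.rfind_dom.trans (exists_congr fun n => ?_)
    rw [Part.mem_some_iff]
    exact ⟨fun h => h.1.symm, fun h => ⟨h.symm, fun _ => trivial⟩⟩

theorem comp {p : β → Prop} (hp : REPred p) {f : α → β} (hf : Computable f) :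
    REPred fun a => p (f a) :=
  Partrec.comp hp hf

theorem lt {f g : α → ℕ} (hf : Computable f) (hg : Computable g) : REPred fun a => f a < g a :=
  (Primrec.nat_lt.computablePred.to_re).comp (hf.pair hg)

theorem eq {f g : α → β} (hf : Computable f) (hg : Computable g) : REPred fun a => f a = g a := by
  classical
  exact (Primrec.eq (α := β)).computablePred.to_re.comp (hf.pair hg)

theorem ne {f g : α → β} (hf : Computable f) (hg : Computable g) : REPred fun a => f a ≠ g a := by
  classical
  exact (Primrec.eq (α := β)).not.computablePred.to_re.comp (hf.pair hg)

theorem and {p q : α → Prop} (hp : REPred p) (hq : REPred q) : REPred fun a => p a ∧ q a := by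
  obtain ⟨P, hP, mP, eP⟩ := hp.exists_primrecPred
  obtain ⟨Q, hQ, mQ, eQ⟩ := hq.exists_primrecPred
  refine (exists_nat (hP.and hQ).computablePred).of_eq fun a => ?_
  rw [eP, eQ]
  constructor
  · rintro ⟨n, h, h'⟩
    exact ⟨⟨n, h⟩, n, h'⟩
  · rintro ⟨⟨n, h⟩, m, h'⟩
    exact ⟨max n m, mP _ _ _ (le_max_left _ _) h, mQ _ _ _ (le_max_right _ _) h'⟩

theorem or {p q : α → Prop} (hp : REPred p) (hq : REPred q) : REPred fun a => p a ∨ q a := by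
  obtain ⟨P, hP, -, eP⟩ := hp.exists_primrecPred
  obtain ⟨Q, hQ, -, eQ⟩ := hq.exists_primrecPred
  refine (exists_nat (hP.or hQ).computablePred).of_eq fun a => ?_
  rw [eP, eQ]
  exact exists_or

/-- The witness and the stage at which it is verified are coded by one natural number, which reduces
the claim to an unbounded search. -/
theorem exists' {p : α → β → Prop} (hp : REPred fun x : α × β => p x.1 x.2) :
    REPred fun a => ∃ b, p a b := by
  obtain ⟨P, hP, -, eP⟩ := hp.exists_primrecPred
  have h : PrimrecPred fun x : (α × ℕ) × β × ℕ => P ((x.1.1, x.2.1), x.2.2) :=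
    hP.comp (((Primrec.fst.comp .fst).pair (Primrec.fst.comp .snd)).pair (Primrec.snd.comp .snd))
  classical
  have h2 : Primrec fun x : α × ℕ => ((Encodable.decode (α := β × ℕ) x.2).bind fun y =>
      if P ((x.1, y.1), y.2) then some y else none).isSome := by
    refine Primrec.option_isSome.comp (Primrec.option_bind (Primrec.decode.comp .snd) ?_)
    exact Primrec.ite (h.comp Primrec.id) (Primrec.option_some.comp .snd) (.const none)
  refine (exists_nat (ComputablePred.computable_iff.2 ⟨_, h2.to_comp, rfl⟩)).of_eq fun a => ?_
  simp only [Option.isSome_iff_exists, Option.bind_eq_some_iff]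
  constructor
  · rintro ⟨n, z, y, -, h⟩
    split_ifs at h with h'
    exact ⟨y.1, (eP _).2 ⟨_, h'⟩⟩
  · rintro ⟨b, hb⟩
    obtain ⟨m, hm⟩ := (eP (a, b)).1 hb
    exact ⟨Encodable.encode (b, m), (b, m), (b, m), Encodable.encodek _, if_pos hm⟩

theorem exists_mem {p : α → β → Prop} {l : α → List β} (hl : Computable l)
    (hp : REPred fun x : α × β => p x.1 x.2) : REPred fun a => ∃ b ∈ l a, p a b := by
  classical
  refine exists' (REPred.and ?_ hp)
  have h : PrimrecPred fun x : List β × β => ∃ b ∈ x.1, b = x.2 :=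
    PrimrecRel.exists_mem_list Primrec.eq
  exact (h.computablePred.to_re.comp ((hl.comp .fst).pair .snd)).of_eq fun x => by simp

theorem mem {f : α → β} {l : α → List β} (hf : Computable f) (hl : Computable l) :
    REPred fun a => f a ∈ l a :=
  (exists_mem (p := fun a b => b = f a) hl (eq .snd (hf.comp .fst))).of_eq fun a => by simp

/-- Stages are monotone, so the finitely many elements of the list are all verified at one common
stage, and a single search suffices. -/
theorem forall_mem {p : α → β → Prop} {l : α → List β} (hl : Computable l)
    (hp : REPred fun x : α × β => p x.1 x.2) : REPred fun a => ∀ b ∈ l a, p a b := by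
  obtain ⟨P, hP, mP, eP⟩ := hp.exists_primrecPred
  have h : PrimrecRel fun (L : List β) (x : α × ℕ) => ∀ b ∈ L, P ((x.1, b), x.2) :=
    PrimrecRel.forall_mem_list (R := fun b (x : α × ℕ) => P ((x.1, b), x.2))
      (hP.comp (((Primrec.fst.comp .snd).pair .fst).pair (Primrec.snd.comp .snd)))
  have h2 : ComputablePred fun x : α × ℕ => ∀ b ∈ l x.1, P ((x.1, b), x.2) := by
    obtain ⟨_, h⟩ := h
    exact ⟨fun _ => Classical.dec _,
      ((h.to_comp.comp ((hl.comp .fst).pair .id))).of_eq fun x => by congr⟩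
  refine (exists_nat h2).of_eq fun a => ?_
  constructor
  · rintro ⟨n, hn⟩ b hb
    exact (eP _).2 ⟨n, hn b hb⟩
  · intro h
    have key : ∀ L : List β, (∀ b ∈ L, p a b) → ∃ n, ∀ b ∈ L, P ((a, b), n) := by
      intro L
      induction L with
      | nil => simp
      | cons b L ih =>
        intro hL
        obtain ⟨n, hn⟩ := ih fun b' hb' => hL b' (by simp [hb'])
        obtain ⟨m, hm⟩ := (eP (a, b)).1 (hL b (by simp))
        refine ⟨max n m, fun b' hb' => ?_⟩
        rcases List.mem_cons.1 hb' with rfl | hb'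
        · exact mP _ _ _ (le_max_right _ _) hm
        · exact mP _ _ _ (le_max_left _ _) (hn b' hb')
    exact key _ h

/-- A recursively enumerable set is the union of a computable increasing sequence of finite
lists. -/
theorem exists_list {p : α → Prop} (hp : REPred p) :
    ∃ E : ℕ → List α, Computable E ∧ (∀ m n, m ≤ n → E m ⊆ E n) ∧ ∀ a, p a ↔ ∃ n, a ∈ E n := by
  obtain ⟨P, hP, mP, eP⟩ := hp.exists_primrecPred
  obtain ⟨_, hP⟩ := hP
  refine ⟨fun n => (List.range n).filterMap fun j => (Encodable.decode (α := α) j).bind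
    fun a => if P (a, n) then some a else none, ?_, ?_, ?_⟩
  · refine Primrec.to_comp (Primrec.listFilterMap Primrec.list_range ?_)
    refine Primrec.option_bind (Primrec.decode.comp .snd) ?_
    exact Primrec.ite (PrimrecPred.comp ⟨_, hP⟩ (Primrec.snd.pair (Primrec.fst.comp .fst)))
      (Primrec.option_some.comp .snd) (.const none)
  · intro m n hmn a ha
    simp only [List.mem_filterMap, List.mem_range, Option.bind_eq_some_iff] at ha ⊢
    obtain ⟨j, hj, b, hb, h⟩ := ha
    split_ifs at h with h'
    exact ⟨j, by omega, b, hb, by rw [if_pos (mP _ _ _ hmn h')]; exact h⟩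
  · intro a
    simp only [List.mem_filterMap, List.mem_range, Option.bind_eq_some_iff]
    rw [eP]
    constructor
    · rintro ⟨m, hm⟩
      exact ⟨max m (Encodable.encode a + 1), Encodable.encode a, by omega, a,
        Encodable.encodek a, by rw [if_pos (mP _ _ _ (le_max_left _ _) hm)]⟩
    · rintro ⟨n, j, -, b, -, h⟩
      split_ifs at h with h'
      exact ⟨n, by simpa using (Option.some.inj h) ▸ h'⟩

end REPred

/-! ### Hat functions and the canonical basis of the space of measures -/

namespace AlgRandom

/-! ### Arithmetic and order on codes of rationals. -/

section Rationals

/-- A code of `ratOf q + 1 / (n + 1)`. -/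
def ratAdd (n : ℕ) (q : ℕ × ℕ × ℕ) : ℕ × ℕ × ℕ :=
  (q.1 * (n + 1) + (q.2.2 + 1), q.2.1 * (n + 1), (q.2.2 + 1) * n + q.2.2)

/-- A code of `ratOf q - 1 / (n + 1)`. -/
def ratSub (n : ℕ) (q : ℕ × ℕ × ℕ) : ℕ × ℕ × ℕ :=
  (q.1 * (n + 1), q.2.1 * (n + 1) + (q.2.2 + 1), (q.2.2 + 1) * n + q.2.2)

/-- Codes store the denominator less one, so the last component is `(c + 1) * (n + 1) - 1`, written
without subtraction; `h3` undoes this. -/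
theorem ratOf_ratAdd (n : ℕ) (q : ℕ × ℕ × ℕ) : ratOf (ratAdd n q) = ratOf q + 1 / ((n : ℝ) + 1) := by
  have h1 : ((q.2.2 : ℝ) + 1) ≠ 0 := by positivity
  have h2 : ((n : ℝ) + 1) ≠ 0 := by positivity
  have h3 : ((q.2.2 : ℝ) + 1) * n + q.2.2 + 1 = (q.2.2 + 1) * (n + 1) := by ring
  simp only [ratOf, ratAdd]
  push_cast
  rw [h3]
  field_simp
  ring

theorem ratOf_ratSub (n : ℕ) (q : ℕ × ℕ × ℕ) : ratOf (ratSub n q) = ratOf q - 1 / ((n : ℝ) + 1) := by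
  have h1 : ((q.2.2 : ℝ) + 1) ≠ 0 := by positivity
  have h2 : ((n : ℝ) + 1) ≠ 0 := by positivity
  have h3 : ((q.2.2 : ℝ) + 1) * n + q.2.2 + 1 = (q.2.2 + 1) * (n + 1) := by ring
  simp only [ratOf, ratSub]
  push_cast
  rw [h3]
  field_simp
  ring

theorem posRatOf_eq_ratOf (q : ℕ × ℕ) : posRatOf q = ratOf (q.1 + 1, 0, q.2) := by
  simp [posRatOf, ratOf]

theorem ratOf_lt_ratOf_iff (p q : ℕ × ℕ × ℕ) : ratOf p < ratOf q ↔
    p.1 * (q.2.2 + 1) + q.2.1 * (p.2.2 + 1) < q.1 * (p.2.2 + 1) + p.2.1 * (q.2.2 + 1) := by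
  rw [ratOf, ratOf, div_lt_div_iff₀ (by positivity) (by positivity)]
  rw [← Nat.cast_lt (α := ℝ)]
  push_cast
  constructor <;> intro h <;> linarith

theorem nnratOf_lt_nnratOf_iff (p q : ℕ × ℕ) :
    nnratOf p < nnratOf q ↔ p.1 * (q.2 + 1) < q.1 * (p.2 + 1) := by
  rw [nnratOf, nnratOf, div_lt_div_iff₀ (by positivity) (by positivity)]
  exact_mod_cast Iff.rfl

theorem exists_nnratOf_btwn {a b : ℝ≥0∞} (h : a < b) :
    ∃ q, a < (nnratOf q : ℝ≥0∞) ∧ (nnratOf q : ℝ≥0∞) < b := by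
  obtain ⟨r, h0, h1, h2⟩ := ENNReal.lt_iff_exists_rat_btwn.1 h
  refine ⟨(r.num.toNat, r.den - 1), ?_⟩
  have : nnratOf (r.num.toNat, r.den - 1) = Real.toNNReal r := by
    apply NNReal.coe_injective
    rw [Real.coe_toNNReal _ (by exact_mod_cast h0)]
    have hd : ((r.den - 1 : ℕ) : ℝ) + 1 = r.den := by
      have := r.den_pos
      rw [Nat.cast_sub (by omega)]; simp
    have hn : ((r.num.toNat : ℕ) : ℝ) = r.num := by
      have := Int.toNat_of_nonneg (Rat.num_nonneg.2 h0)
      exact_mod_cast congrArg (Int.cast (R := ℝ)) this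
    simp only [nnratOf, NNReal.coe_div, NNReal.coe_natCast, NNReal.coe_add, NNReal.coe_one]
    rw [hd, hn]
    exact (Rat.cast_def r).symm
  rw [this]
  exact ⟨h1, h2⟩

theorem exists_posRatOf_btwn {a b : ℝ} (ha : 0 ≤ a) (h : a < b) :
    ∃ q, a < posRatOf q ∧ posRatOf q < b := by
  obtain ⟨q, h1, h2⟩ := exists_nnratOf_btwn
    ((ENNReal.ofReal_lt_ofReal_iff_of_nonneg ha).2 h)
  rw [← ENNReal.ofReal_coe_nnreal] at h1 h2
  have h1 := (ENNReal.ofReal_lt_ofReal_iff_of_nonneg ha).1 h1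
  have h2 := (ENNReal.ofReal_lt_ofReal_iff_of_nonneg (nnratOf q).2).1 h2
  -- Codes of positive rationals store the numerator less one, so the numerator has to be nonzero
  -- before it is decremented.
  have hq : q.1 ≠ 0 := fun h0 => by
    simp only [nnratOf, h0, Nat.cast_zero, zero_div, NNReal.coe_zero] at h1
    linarith
  have h3 : posRatOf (q.1 - 1, q.2) = nnratOf q := by
    simp only [posRatOf, nnratOf]
    rw [Nat.cast_sub (Nat.one_le_iff_ne_zero.2 hq)]
    simp
  exact ⟨(q.1 - 1, q.2), h3 ▸ h1, h3 ▸ h2⟩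

/-- A sufficiently small radius `1 / (n + 1)`. -/
theorem exists_forall_one_div_lt {δ : ℝ} (hδ : 0 < δ) :
    ∃ N : ℕ, ∀ n : ℕ, N ≤ n → 1 / ((n : ℝ) + 1) < δ := by
  obtain ⟨N, hN⟩ := exists_nat_one_div_lt hδ
  exact ⟨N, fun n hn => (Nat.one_div_le_one_div hn).trans_lt hN⟩

end Rationals

/-! ### Hat functions as continuous approximations of balls from inside. -/

section Hats

variable {X : Type*} [MetricSpace X] (𝒳 : ComputableMetric X)

theorem continuous_hatOf (c : HatCode) : Continuous (𝒳.hatOf c) := by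
  unfold ComputableMetric.hatOf hat
  fun_prop

theorem hatOf_le_one (c : HatCode) (x : X) : 𝒳.hatOf c x ≤ 1 := by
  have : 0 ≤ max (dist x (𝒳.α c.1) - ratOf c.2.1) 0 / (1 / ((c.2.2 : ℝ) + 1)) :=
    div_nonneg (le_max_right _ _) (by positivity)
  exact max_le (by linarith) zero_le_one

theorem maxHat_le_iff (L : List HatCode) (x : X) (r : ℝ) :
    𝒳.maxHat L x ≤ r ↔ 0 ≤ r ∧ ∀ c ∈ L, 𝒳.hatOf c x ≤ r := by
  unfold ComputableMetric.maxHat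
  induction L with
  | nil => simp
  | cons c L ih =>
    simp only [List.map_cons, List.foldr_cons, max_le_iff, ih, List.mem_cons, forall_eq_or_imp]
    tauto

theorem maxHat_nonneg (L : List HatCode) (x : X) : 0 ≤ 𝒳.maxHat L x :=
  ((maxHat_le_iff 𝒳 L x _).1 le_rfl).1

theorem hatOf_le_maxHat {L : List HatCode} {c : HatCode} (hc : c ∈ L) (x : X) :
    𝒳.hatOf c x ≤ 𝒳.maxHat L x :=
  ((maxHat_le_iff 𝒳 L x _).1 le_rfl).2 c hc

theorem maxHat_le_one (L : List HatCode) (x : X) : 𝒳.maxHat L x ≤ 1 :=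
  (maxHat_le_iff 𝒳 L x _).2 ⟨zero_le_one, fun c _ => hatOf_le_one 𝒳 c x⟩

theorem continuous_maxHat (L : List HatCode) : Continuous (𝒳.maxHat L) := by
  unfold ComputableMetric.maxHat
  induction L with
  | nil => exact continuous_const
  | cons c L ih => exact (continuous_hatOf 𝒳 c).max ih

theorem maxHat_mono {L L' : List HatCode} (h : L ⊆ L') (x : X) : 𝒳.maxHat L x ≤ 𝒳.maxHat L' x :=
  (maxHat_le_iff 𝒳 L x _).2 ⟨maxHat_nonneg 𝒳 L' x, fun _ hc => hatOf_le_maxHat 𝒳 (h hc) x⟩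

/-- A hat function supported in the ball `b`, which is `1` at the points at depth at least
`1 / (n + 1)` in it. -/
def innerHat (b : ℕ × ℕ × ℕ) (n : ℕ) : HatCode := (b.1, ratSub n (b.2.1 + 1, 0, b.2.2), n)

/-- In this form the hat is `n + 1` times the depth of `x` in the ball, clamped to `[0, 1]`;
monotonicity in `n` and the values 0 and 1 are read off from it. -/
theorem hatOf_innerHat (b : ℕ × ℕ × ℕ) (n : ℕ) (x : X) : 𝒳.hatOf (innerHat b n) x =
    max (min 1 (((n : ℝ) + 1) * (posRatOf b.2 - dist x (𝒳.α b.1)))) 0 := by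
  have hn : (0 : ℝ) < (n : ℝ) + 1 := by positivity
  simp only [ComputableMetric.hatOf, hat, innerHat, ratOf_ratSub, ← posRatOf_eq_ratOf b.2]
  have h : (dist x (𝒳.α b.1) - (posRatOf b.2 - 1 / ((n : ℝ) + 1))) / (1 / ((n : ℝ) + 1)) =
      1 - ((n : ℝ) + 1) * (posRatOf b.2 - dist x (𝒳.α b.1)) := by
    field_simp
    ring
  congr 1
  rw [← max_div_div_right (by positivity), h, zero_div]
  rcases le_total (((n : ℝ) + 1) * (posRatOf b.2 - dist x (𝒳.α b.1))) 1 with h1 | h1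
  · rw [max_eq_left (by linarith), min_eq_right h1]
    ring
  · rw [max_eq_right (by linarith), min_eq_left h1]
    ring

theorem hatOf_innerHat_mono (b : ℕ × ℕ × ℕ) {m n : ℕ} (h : m ≤ n) (x : X) :
    𝒳.hatOf (innerHat b m) x ≤ 𝒳.hatOf (innerHat b n) x := by
  rw [hatOf_innerHat, hatOf_innerHat]
  have hmn : (m : ℝ) ≤ n := by exact_mod_cast h
  have hm : (0 : ℝ) ≤ m := by positivity
  rcases le_total 0 (posRatOf b.2 - dist x (𝒳.α b.1)) with h0 | h0
  · gcongr
  · rw [max_eq_right]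
    · exact le_max_right _ _
    · exact (min_le_right _ _).trans (mul_nonpos_of_nonneg_of_nonpos (by positivity) h0)

theorem hatOf_innerHat_eq_one {b : ℕ × ℕ × ℕ} {n : ℕ} {x : X}
    (h : dist x (𝒳.α b.1) + 1 / ((n : ℝ) + 1) ≤ posRatOf b.2) : 𝒳.hatOf (innerHat b n) x = 1 := by
  have hn : (0 : ℝ) < (n : ℝ) + 1 := by positivity
  have h1 : 1 ≤ ((n : ℝ) + 1) * (posRatOf b.2 - dist x (𝒳.α b.1)) := by
    have := mul_le_mul_of_nonneg_left (le_sub_iff_add_le'.2 h) hn.le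
    rwa [mul_one_div_cancel hn.ne'] at this
  rw [hatOf_innerHat, min_eq_left h1, max_eq_left zero_le_one]

theorem hatOf_innerHat_eq_zero {b : ℕ × ℕ × ℕ} {x : X} (n : ℕ) (h : x ∉ 𝒳.ball b) :
    𝒳.hatOf (innerHat b n) x = 0 := by
  rw [ComputableMetric.ball, Metric.mem_ball, not_lt] at h
  rw [hatOf_innerHat, max_eq_right]
  exact (min_le_right _ _).trans
    (mul_nonpos_of_nonneg_of_nonpos (by positivity) (by linarith))

/-- Every point lies in canonical balls that are contained in arbitrarily small balls around it. -/
theorem exists_ball_mem (x : X) {δ : ℝ} (hδ : 0 < δ) :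
    ∃ b, x ∈ 𝒳.ball b ∧ dist x (𝒳.α b.1) + posRatOf b.2 < δ := by
  obtain ⟨N, hN⟩ := exists_nat_one_div_lt (half_pos hδ)
  obtain ⟨i, hi⟩ := 𝒳.dense.exists_dist_lt x (ε := 1 / ((N : ℝ) + 1)) (by positivity)
  have hr : posRatOf (0, N) = 1 / ((N : ℝ) + 1) := by simp [posRatOf]
  refine ⟨(i, 0, N), ?_, ?_⟩
  · rw [ComputableMetric.ball, Metric.mem_ball, hr]
    exact hi
  · rw [hr]
    dsimp only
    linarith

end Hats

/-! ### Shrinking subbasis sets of measures, and openness of the basis. -/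

section Measures

variable {X : Type*} [MetricSpace X] [MeasurableSpace X]

/-- Code of a set of the canonical subbasis of the space of measures. -/
abbrev SubCode : Type := Bool × List HatCode × (ℕ × ℕ × ℕ)

/-- Move the bound of a subbasis set inwards by `1 / (n + 1)`. -/
def shrink (n : ℕ) (c : SubCode) : SubCode :=
  (c.1, c.2.1, bif c.1 then ratAdd n c.2.2 else ratSub n c.2.2)

/-- The opposite strict inequality. -/
def flip (c : SubCode) : SubCode := (!c.1, c.2.1, c.2.2)

variable (𝒳 : ComputableMetric X)

theorem mem_measSubbasis_false {L : List HatCode} {q : ℕ × ℕ × ℕ} {μ : ProbabilityMeasure X} :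
    μ ∈ 𝒳.measSubbasis (false, L, q) ↔ ∫ x, 𝒳.maxHat L x ∂(μ : Measure X) < ratOf q := Iff.rfl

theorem mem_measSubbasis_true {L : List HatCode} {q : ℕ × ℕ × ℕ} {μ : ProbabilityMeasure X} :
    μ ∈ 𝒳.measSubbasis (true, L, q) ↔ ratOf q < ∫ x, 𝒳.maxHat L x ∂(μ : Measure X) := Iff.rfl

/-- Applied to `shrink n c`, this is one half of a sandwich whose other half is
`mem_of_notMem_flip_shrink`: the complement of `flip (shrink n c)` is a closed condition between the
open conditions `shrink n c` and `c`. That closed condition defines activity. -/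
theorem notMem_flip_of_mem {c : SubCode} {μ : ProbabilityMeasure X} (h : μ ∈ 𝒳.measSubbasis c) :
    μ ∉ 𝒳.measSubbasis (flip c) := by
  obtain ⟨_ | _, L, q⟩ := c
  · exact fun h' => lt_asymm (α := ℝ) h h'
  · exact fun h' => lt_asymm (α := ℝ) h h'

theorem mem_of_notMem_flip_shrink {c : SubCode} {n : ℕ} {μ : ProbabilityMeasure X}
    (h : μ ∉ 𝒳.measSubbasis (flip (shrink n c))) : μ ∈ 𝒳.measSubbasis c := by
  have hn : (0 : ℝ) < 1 / ((n : ℝ) + 1) := by positivity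
  obtain ⟨_ | _, L, q⟩ := c <;>
    simp only [flip, shrink, Bool.not_false, Bool.not_true, cond_true, cond_false,
      mem_measSubbasis_true, mem_measSubbasis_false, ratOf_ratAdd, ratOf_ratSub, not_lt] at h ⊢ <;>
    linarith

theorem notMem_flip_shrink_mono {c : SubCode} {m n : ℕ} (hmn : m ≤ n) {μ : ProbabilityMeasure X}
    (h : μ ∉ 𝒳.measSubbasis (flip (shrink m c))) : μ ∉ 𝒳.measSubbasis (flip (shrink n c)) := by
  have hn : 1 / ((n : ℝ) + 1) ≤ 1 / ((m : ℝ) + 1) := Nat.one_div_le_one_div hmn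
  obtain ⟨_ | _, L, q⟩ := c <;>
    simp only [flip, shrink, Bool.not_false, Bool.not_true, cond_true, cond_false,
      mem_measSubbasis_true, mem_measSubbasis_false, ratOf_ratAdd, ratOf_ratSub, not_lt] at h ⊢ <;>
    linarith

theorem exists_forall_mem_shrink {c : SubCode} {μ : ProbabilityMeasure X}
    (h : μ ∈ 𝒳.measSubbasis c) : ∃ N, ∀ n, N ≤ n → μ ∈ 𝒳.measSubbasis (shrink n c) := by
  obtain ⟨_ | _, L, q⟩ := c <;>
    simp only [shrink, cond_true, cond_false,
      mem_measSubbasis_true, mem_measSubbasis_false, ratOf_ratAdd, ratOf_ratSub] at h ⊢ <;>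
    obtain ⟨N, hN⟩ := exists_forall_one_div_lt (sub_pos.2 h) <;>
    exact ⟨N, fun n hn => by linarith [hN n hn]⟩

theorem exists_forall_mem_shrink_list {V : List SubCode} {μ : ProbabilityMeasure X}
    (h : μ ∈ 𝒳.measBasis V) :
    ∃ N, ∀ n, N ≤ n → ∀ c ∈ V, μ ∈ 𝒳.measSubbasis (shrink n c) := by
  induction V with
  | nil => simp
  | cons c V ih =>
    obtain ⟨N, hN⟩ := ih fun c' hc' => h c' (by simp [hc'])
    obtain ⟨M, hM⟩ := exists_forall_mem_shrink 𝒳 (h c (by simp))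
    refine ⟨max N M, fun n hn c' hc' => ?_⟩
    rcases List.mem_cons.1 hc' with rfl | hc'
    · exact hM n (le_of_max_le_right hn)
    · exact hN n (le_of_max_le_left hn) c' hc'

theorem mem_measBasis_nil (μ : ProbabilityMeasure X) : μ ∈ 𝒳.measBasis [] := by
  simp [ComputableMetric.measBasis]

theorem mem_measBasis_append {L M : List SubCode} {μ : ProbabilityMeasure X} :
    μ ∈ 𝒳.measBasis (L ++ M) ↔ μ ∈ 𝒳.measBasis L ∧ μ ∈ 𝒳.measBasis M := by
  simp [ComputableMetric.measBasis, or_imp, forall_and]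

variable [BorelSpace X]

theorem integrable_maxHat (L : List HatCode) (μ : ProbabilityMeasure X) :
    Integrable (𝒳.maxHat L) (μ : Measure X) :=
  Integrable.of_bound (continuous_maxHat 𝒳 L).measurable.aestronglyMeasurable 1
    (.of_forall fun x => by
      rw [Real.norm_of_nonneg (maxHat_nonneg 𝒳 L x)]
      exact maxHat_le_one 𝒳 L x)

theorem lintegral_maxHat (L : List HatCode) (μ : ProbabilityMeasure X) :
    ∫⁻ x, ENNReal.ofReal (𝒳.maxHat L x) ∂(μ : Measure X) =
      ENNReal.ofReal (∫ x, 𝒳.maxHat L x ∂(μ : Measure X)) :=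
  (ofReal_integral_eq_lintegral_ofReal (integrable_maxHat 𝒳 L μ)
    (.of_forall fun x => maxHat_nonneg 𝒳 L x)).symm

theorem integral_maxHat_mono {L L' : List HatCode} (h : L ⊆ L') (μ : ProbabilityMeasure X) :
    ∫ x, 𝒳.maxHat L x ∂(μ : Measure X) ≤ ∫ x, 𝒳.maxHat L' x ∂(μ : Measure X) :=
  integral_mono (integrable_maxHat 𝒳 L μ) (integrable_maxHat 𝒳 L' μ) fun x => maxHat_mono 𝒳 h x

theorem continuous_integral_maxHat (L : List HatCode) :
    Continuous fun μ : ProbabilityMeasure X => ∫ x, 𝒳.maxHat L x ∂(μ : Measure X) := by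
  let f : BoundedContinuousFunction X ℝ := BoundedContinuousFunction.ofNormedAddCommGroup
    (𝒳.maxHat L) (continuous_maxHat 𝒳 L) 1 fun x => by
      rw [Real.norm_of_nonneg (maxHat_nonneg 𝒳 L x)]
      exact maxHat_le_one 𝒳 L x
  exact continuous_iff_continuousAt.2 fun μ =>
    (ProbabilityMeasure.tendsto_iff_forall_integral_tendsto.1 (Filter.tendsto_id (x := nhds μ))) f

theorem isOpen_measSubbasis (c : SubCode) : IsOpen (𝒳.measSubbasis c) := by
  obtain ⟨_ | _, L, q⟩ := c
  · exact isOpen_lt (continuous_integral_maxHat 𝒳 L) continuous_const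
  · exact isOpen_lt continuous_const (continuous_integral_maxHat 𝒳 L)

theorem isOpen_measBasis (L : List SubCode) : IsOpen (𝒳.measBasis L) := by
  have : 𝒳.measBasis L = ⋂ c ∈ {c | c ∈ L}, 𝒳.measSubbasis c := by
    ext μ
    simp [ComputableMetric.measBasis]
  rw [this]
  exact (List.finite_toSet L).isOpen_biInter fun c _ => isOpen_measSubbasis 𝒳 c

end Measures

section Codes

variable {α : Type*} [Primcodable α]

@[fun_prop]
theorem computable_ratAdd {f : α → ℕ} {g : α → ℕ × ℕ × ℕ} (hf : Computable f)
    (hg : Computable g) : Computable fun a => ratAdd (f a) (g a) := by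
  unfold ratAdd; fun_prop

@[fun_prop]
theorem computable_ratSub {f : α → ℕ} {g : α → ℕ × ℕ × ℕ} (hf : Computable f)
    (hg : Computable g) : Computable fun a => ratSub (f a) (g a) := by
  unfold ratSub; fun_prop

@[fun_prop]
theorem computable_innerHat {f : α → ℕ × ℕ × ℕ} {g : α → ℕ} (hf : Computable f)
    (hg : Computable g) : Computable fun a => innerHat (f a) (g a) := by
  unfold innerHat; fun_prop

@[fun_prop]
theorem computable_shrink {f : α → ℕ} {g : α → SubCode} (hf : Computable f)
    (hg : Computable g) : Computable fun a => shrink (f a) (g a) := by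
  have : Computable fun a => bif (g a).1 then ratAdd (f a) (g a).2.2 else ratSub (f a) (g a).2.2 :=
    Computable.cond (by fun_prop) (by fun_prop) (by fun_prop)
  unfold shrink; fun_prop

@[fun_prop]
theorem computable_flip {g : α → SubCode} (hg : Computable g) : Computable fun a => flip (g a) := by
  unfold flip; fun_prop

theorem rePred_ratOf_lt {f g : α → ℕ × ℕ × ℕ} (hf : Computable f) (hg : Computable g) :
    REPred fun a => ratOf (f a) < ratOf (g a) := by
  simp_rw [ratOf_lt_ratOf_iff]
  exact REPred.lt (by fun_prop) (by fun_prop)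

theorem rePred_nnratOf_lt {f g : α → ℕ × ℕ} (hf : Computable f) (hg : Computable g) :
    REPred fun a => nnratOf (f a) < nnratOf (g a) := by
  simp_rw [nnratOf_lt_nnratOf_iff]
  exact REPred.lt (by fun_prop) (by fun_prop)

end Codes

end AlgRandom

/-! ### Trimming: extending a test on a class of measures to a uniform test -/

namespace AlgRandom

/-- A canonical basis set of `X × ProbabilityMeasure X`, together with a level. -/
abbrev LevelCode : Type := ((ℕ × ℕ × ℕ) × List SubCode) × ℕ

/-- `∑ 2 ^ k * l[k]` over `k < n`. -/
def weightedSum (l : List ℕ) (n : ℕ) : ℕ := ∑ k ∈ Finset.range n, 2 ^ k * l.getD k 0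

@[fun_prop]
theorem computable_getD {α : Type*} [Primcodable α] {l : α → List ℕ} {n : α → ℕ}
    (hl : Computable l) (hn : Computable n) : Computable fun a => (l a).getD (n a) 0 :=
  (Primrec.list_getD 0).to_comp.comp hl hn

@[fun_prop]
theorem computable_weightedSum {α : Type*} [Primcodable α] {l : α → List ℕ} {n : α → ℕ}
    (hl : Computable l) (hn : Computable n) : Computable fun a => weightedSum (l a) (n a) := by
  have h : Computable fun a => Nat.rec (motive := fun _ => ℕ) 0
      (fun k s => s + 2 ^ k * (l a).getD k 0) (n a) := by
    refine Computable.nat_rec hn (Computable.const 0)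
      (h := fun a p => p.2 + 2 ^ p.1 * (l a).getD p.1 0) ?_
    unfold Computable₂
    fun_prop
  refine h.of_eq fun a => ?_
  unfold weightedSum
  generalize n a = m
  induction m with
  | zero => rfl
  | succ m ih => rw [Finset.sum_range_succ, ← ih]

/-- The list `M` of bounds on integrals certifies that the part of `E` enumerated up to stage `n`
has a small integral. -/
def Certifies (E : ℕ → List LevelCode) (n : ℕ) (M : List SubCode) : Prop :=
  ∃ a : List ℕ × ℕ, weightedSum a.1 n < 3 * (a.2 + 1) ∧ ∀ k ∈ List.range n, ∃ H : List HatCode,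
    (false, H, (a.1.getD k 0, 0, a.2)) ∈ M ∧ ∀ e ∈ E n, e.2 ≠ k ∨ innerHat e.1.1 n ∈ H ∨
      ∃ c ∈ e.1.2, flip (shrink n c) ∈ M

/-- The canonical basis set with code `i` is contained in the trimmed set of level `k`. -/
def TrimCode (E : ℕ → List LevelCode) (k : ℕ) (i : (ℕ × ℕ × ℕ) × List SubCode) : Prop :=
  ∃ n, k < n ∧ Certifies E n i.2 ∧ ∃ e ∈ E n, e.2 = k ∧ i.1.1 = e.1.1.1 ∧
    ratOf (ratAdd n (i.1.2.1 + 1, 0, i.1.2.2)) < ratOf (e.1.1.2.1 + 1, 0, e.1.1.2.2) ∧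
    ∀ c ∈ e.1.2, shrink n c ∈ i.2

theorem Certifies.mono {E : ℕ → List LevelCode} {n : ℕ} {M M' : List SubCode}
    (h : Certifies E n M) (hM : M ⊆ M') : Certifies E n M' := by
  obtain ⟨a, ha, h⟩ := h
  refine ⟨a, ha, fun k hk => ?_⟩
  obtain ⟨H, hH, h⟩ := h k hk
  exact ⟨H, hM hH, fun e he => (h e he).imp_right
    (Or.imp_right fun ⟨c, hc, hcM⟩ => ⟨c, hc, hM hcM⟩)⟩

theorem rePred_certifies {E : ℕ → List LevelCode} (hE : Computable E) :
    REPred fun x : ℕ × List SubCode => Certifies E x.1 x.2 := by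
  unfold Certifies
  refine .exists' (.and (.lt (by fun_prop) (by fun_prop)) (.forall_mem (by fun_prop) ?_))
  refine .exists' (.and (.mem (by fun_prop) (by fun_prop)) (.forall_mem (by fun_prop) ?_))
  refine .or (.ne (by fun_prop) (by fun_prop)) (.or (.mem (by fun_prop) (by fun_prop)) ?_)
  exact .exists_mem (by fun_prop) (.mem (by fun_prop) (by fun_prop))

theorem rePred_trimCode {E : ℕ → List LevelCode} (hE : Computable E) :
    REPred fun x : ℕ × ((ℕ × ℕ × ℕ) × List SubCode) => TrimCode E x.1 x.2 := by
  unfold TrimCode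
  refine .exists' (.and (.lt (by fun_prop) (by fun_prop)) (.and ?_ (.exists_mem (by fun_prop) ?_)))
  · exact (rePred_certifies hE).comp (f := fun x : (ℕ × (ℕ × ℕ × ℕ) × List SubCode) × ℕ =>
      (x.2, x.1.2.2)) (by fun_prop)
  · refine .and (.eq (by fun_prop) (by fun_prop)) (.and (.eq (by fun_prop) (by fun_prop)) (.and ?_ ?_))
    · exact rePred_ratOf_lt (by fun_prop) (by fun_prop)
    · exact .forall_mem (by fun_prop) (.mem (by fun_prop) (by fun_prop))

/-! ### Certified stages and the integral of the trimmed function. -/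

section

variable {X : Type*} [MetricSpace X] [MeasurableSpace X] (𝒳 : ComputableMetric X)

open Classical in
/-- The hats of the elements of level `k` of the list `L` that are active, up to `1 / (n + 1)`,
at `μ`. -/
noncomputable def activeHats (L : List LevelCode) (k n : ℕ) (μ : ProbabilityMeasure X) :
    List HatCode :=
  (L.filter fun e => decide (e.2 = k ∧ ∀ c ∈ e.1.2, μ ∉ 𝒳.measSubbasis (flip (shrink n c)))).map
    fun e => innerHat e.1.1 n

theorem mem_activeHats {L : List LevelCode} {k n : ℕ} {μ : ProbabilityMeasure X} {h : HatCode} :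
    h ∈ activeHats 𝒳 L k n μ ↔ ∃ e ∈ L, (e.2 = k ∧
      ∀ c ∈ e.1.2, μ ∉ 𝒳.measSubbasis (flip (shrink n c))) ∧ innerHat e.1.1 n = h := by
  simp only [activeHats, List.mem_map, List.mem_filter, decide_eq_true_eq, and_assoc]

/-- The integral of the part of `E` enumerated up to stage `n` is small at `μ`. -/
def IsSmallAt (E : ℕ → List LevelCode) (n : ℕ) (μ : ProbabilityMeasure X) : Prop :=
  ∑ k ∈ Finset.range n, 2 ^ k * ∫ x, 𝒳.maxHat (activeHats 𝒳 (E n) k n μ) x ∂(μ : Measure X) < 3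

/-- The trimmed function. -/
noncomputable def trim (E : ℕ → List LevelCode) (μ : ProbabilityMeasure X) (x : X) : ℝ≥0∞ :=
  max 1 (⨆ k : ℕ, ⨆ _ : ∃ i, TrimCode E k i ∧ (x, μ) ∈ prodBasis 𝒳.ball 𝒳.measBasis i, 2 ^ k)

/-- The part of the trimmed function enumerated up to stage `n`. -/
noncomputable def stage (E : ℕ → List LevelCode) (n : ℕ) (μ : ProbabilityMeasure X) (x : X) : ℝ≥0∞ :=
  ∑ k ∈ Finset.range n, 2 ^ k * ENNReal.ofReal (𝒳.maxHat (activeHats 𝒳 (E n) k n μ) x)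

variable {𝒳} {E : ℕ → List LevelCode}

/-- Everything grows with the stage: the enumerated list, each inner hat, and the closed sets on
which a code is active. -/
theorem maxHat_activeHats_mono (hE : ∀ m n, m ≤ n → E m ⊆ E n) (k : ℕ) {m n : ℕ} (h : m ≤ n)
    (μ : ProbabilityMeasure X) (x : X) : 𝒳.maxHat (activeHats 𝒳 (E m) k m μ) x ≤
      𝒳.maxHat (activeHats 𝒳 (E n) k n μ) x := by
  refine (maxHat_le_iff 𝒳 _ _ _).2 ⟨maxHat_nonneg _ _ _, fun c hc => ?_⟩
  obtain ⟨e, he, ⟨hk, hact⟩, rfl⟩ := (mem_activeHats 𝒳).1 hc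
  refine (hatOf_innerHat_mono 𝒳 _ h x).trans (hatOf_le_maxHat 𝒳 ((mem_activeHats 𝒳).2
    ⟨e, hE m n h he, ⟨hk, fun c hc => notMem_flip_shrink_mono 𝒳 h (hact c hc)⟩, rfl⟩) x)

theorem stage_mono (hE : ∀ m n, m ≤ n → E m ⊆ E n) {m n : ℕ} (h : m ≤ n)
    (μ : ProbabilityMeasure X) (x : X) : stage 𝒳 E m μ x ≤ stage 𝒳 E n μ x := by
  refine (Finset.sum_le_sum_of_subset (Finset.range_mono h)).trans
    (Finset.sum_le_sum fun k _ => ?_)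
  gcongr
  exact maxHat_activeHats_mono hE k h μ x

variable {μ : ProbabilityMeasure X}

theorem sum_two_pow_mul_lt {n : ℕ} {a : List ℕ × ℕ} (ha : weightedSum a.1 n < 3 * (a.2 + 1)) :
    ∑ k ∈ Finset.range n, 2 ^ k * ratOf (a.1.getD k 0, 0, a.2) < 3 := by
  have h : ∑ k ∈ Finset.range n, 2 ^ k * ratOf (a.1.getD k 0, 0, a.2) =
      (weightedSum a.1 n : ℝ) / ((a.2 : ℝ) + 1) := by
    simp only [weightedSum, ratOf, Nat.cast_sum, Finset.sum_div]
    refine Finset.sum_congr rfl fun k _ => ?_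
    push_cast
    ring
  rw [h, div_lt_iff₀ (by positivity)]
  exact_mod_cast ha

/-- Finitely many reals can be approximated from above by fractions with a common denominator. -/
theorem exists_weightedSum_lt {n : ℕ} {r : ℕ → ℝ} (hr : ∀ k, 0 ≤ r k)
    (h : ∑ k ∈ Finset.range n, 2 ^ k * r k < 3) :
    ∃ a : List ℕ × ℕ, weightedSum a.1 n < 3 * (a.2 + 1) ∧
      ∀ k < n, r k < ratOf (a.1.getD k 0, 0, a.2) := by
  -- Rounding each `r k` up to denominator `N + 1` raises the weighted sum by at most `(∑ 2 ^ k) /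
  -- (N + 1)`; this `N` keeps that below the gap to 3.
  obtain ⟨N, hN⟩ := exists_nat_gt
    ((∑ k ∈ Finset.range n, 2 ^ k) / (3 - ∑ k ∈ Finset.range n, 2 ^ k * r k) : ℝ)
  have hN' : ((∑ k ∈ Finset.range n, 2 ^ k : ℝ)) <
      ((N : ℝ) + 1) * (3 - ∑ k ∈ Finset.range n, 2 ^ k * r k) := by
    rw [← div_lt_iff₀ (by linarith)]
    linarith
  set f : ℕ → ℕ := fun k => ⌊r k * ((N : ℝ) + 1)⌋₊ + 1 with hf
  have hget : ∀ k < n, ((List.range n).map f).getD k 0 = f k := fun k hk => by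
    simp [List.getD_eq_getElem?_getD, hk]
  refine ⟨((List.range n).map f, N), ?_, fun k hk => ?_⟩
  · have h1 : (weightedSum ((List.range n).map f) n : ℝ) ≤
        ∑ k ∈ Finset.range n, 2 ^ k * (r k * ((N : ℝ) + 1) + 1) := by
      unfold weightedSum
      push_cast
      refine Finset.sum_le_sum fun k hk => ?_
      rw [hget k (Finset.mem_range.1 hk)]
      refine mul_le_mul_of_nonneg_left ?_ (by positivity)
      simp only [hf, Nat.cast_add, Nat.cast_one]
      have := Nat.floor_le (mul_nonneg (hr k) (by positivity : (0 : ℝ) ≤ (N : ℝ) + 1))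
      linarith
    have h2 : ∑ k ∈ Finset.range n, (2 : ℝ) ^ k * (r k * ((N : ℝ) + 1) + 1) =
        (∑ k ∈ Finset.range n, 2 ^ k * r k) * ((N : ℝ) + 1) + ∑ k ∈ Finset.range n, 2 ^ k := by
      rw [Finset.sum_mul, ← Finset.sum_add_distrib]
      exact Finset.sum_congr rfl fun k _ => by ring
    have h3 : (weightedSum ((List.range n).map f) n : ℝ) < 3 * ((N : ℝ) + 1) := by
      rw [h2] at h1
      linarith
    exact_mod_cast h3
  · dsimp only
    rw [hget k hk, ratOf, lt_div_iff₀ (by positivity)]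
    simpa [hf] using Nat.lt_floor_add_one (r k * ((N : ℝ) + 1))

/-- The certificate consists of strict rational upper bounds on the integrals of the active hats,
together with all the flipped conditions that hold at `μ`; the latter witness that the remaining
codes are inactive. -/
theorem IsSmallAt.exists_certifies {n : ℕ} (h : IsSmallAt 𝒳 E n μ) :
    ∃ M, Certifies E n M ∧ μ ∈ 𝒳.measBasis M := by
  obtain ⟨a, ha, hr⟩ := exists_weightedSum_lt
    (fun k => integral_nonneg fun x => maxHat_nonneg 𝒳 (activeHats 𝒳 (E n) k n μ) x) h
  classical
  refine ⟨(List.range n).map (fun k => (false, activeHats 𝒳 (E n) k n μ, (a.1.getD k 0, 0, a.2))) ++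
    (((E n).flatMap fun e => e.1.2.map fun c => flip (shrink n c)).filter
      fun c => μ ∈ 𝒳.measSubbasis c), ?_, (mem_measBasis_append 𝒳).2 ⟨?_, ?_⟩⟩
  · refine ⟨a, ha, fun k hk => ⟨activeHats 𝒳 (E n) k n μ,
      List.mem_append_left _ (List.mem_map.2 ⟨k, hk, rfl⟩), fun e he => ?_⟩⟩
    by_cases hek : e.2 = k
    · by_cases hact : ∀ c ∈ e.1.2, μ ∉ 𝒳.measSubbasis (flip (shrink n c))
      · exact .inr (.inl ((mem_activeHats 𝒳).2 ⟨e, he, ⟨hek, hact⟩, rfl⟩))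
      · push Not at hact
        obtain ⟨c, hc, hcμ⟩ := hact
        refine .inr (.inr ⟨c, hc, List.mem_append_right _ (List.mem_filter.2 ⟨?_, by simpa using hcμ⟩)⟩)
        exact List.mem_flatMap.2 ⟨e, he, List.mem_map.2 ⟨c, hc, rfl⟩⟩
    · exact .inl hek
  · intro c hc
    obtain ⟨k, hk, rfl⟩ := List.mem_map.1 hc
    exact hr k (List.mem_range.1 hk)
  · intro c hc
    simpa using (List.mem_filter.1 hc).2

theorem nnratOf_mul_four_lt_two_pow_iff (q : ℕ × ℕ) (k : ℕ) :
    (nnratOf q : ℝ≥0∞) * 4 < 2 ^ k ↔ q.1 * 4 < 2 ^ k * (q.2 + 1) := by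
  have h : (nnratOf q : ℝ≥0∞) * 4 < 2 ^ k ↔ nnratOf q * 4 < 2 ^ k := by exact_mod_cast Iff.rfl
  rw [h, nnratOf, div_mul_eq_mul_div, div_lt_iff₀ (by positivity)]
  exact_mod_cast Iff.rfl

theorem jointlyLSCOn_trim (hE : Computable E) :
    JointlyLSCOn 𝒳 univ fun μ x => trim 𝒳 E μ x / 4 := by
  -- The first disjunct accounts for the constant 1 in `trim`; the factor 4 clears the division.
  refine ⟨fun i => i.2.1 * 4 < 2 ^ 0 * (i.2.2 + 1) ∨
    ∃ k, i.2.1 * 4 < 2 ^ k * (i.2.2 + 1) ∧ TrimCode E k i.1, ?_, ?_⟩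
  · refine .or (.lt (by fun_prop) (by fun_prop)) (.exists' (.and (.lt (by fun_prop) (by fun_prop)) ?_))
    exact (rePred_trimCode hE).comp (f := fun x : (((ℕ × ℕ × ℕ) × List SubCode) × ℕ × ℕ) × ℕ =>
      (x.2, x.1.1)) (by fun_prop)
  · rintro ⟨x, μ⟩ - q
    dsimp only
    rw [ENNReal.lt_div_iff_mul_lt (by simp) (by simp), trim, lt_max_iff, ← pow_zero 2]
    simp only [lt_iSup_iff, ← nnratOf_mul_four_lt_two_pow_iff]
    constructor
    · rintro (h | ⟨k, ⟨i, hi, hx⟩, hk⟩)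
      · obtain ⟨b, hb, -⟩ := exists_ball_mem 𝒳 x one_pos
        exact ⟨(b, []), .inl h, hb, mem_measBasis_nil 𝒳 μ⟩
      · exact ⟨i, .inr ⟨k, hk, hi⟩, hx⟩
    · rintro ⟨i, h | ⟨k, hk, hi⟩, hx⟩
      · exact .inl h
      · exact .inr ⟨k, ⟨i, hi, hx⟩, hk⟩

theorem JointlyLSCOn.mono {S T : Set (X × ProbabilityMeasure X)}
    {f : ProbabilityMeasure X → X → ℝ≥0∞} (hf : JointlyLSCOn 𝒳 T f) (h : S ⊆ T) :
    JointlyLSCOn 𝒳 S f := by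
  obtain ⟨W, hW, hf⟩ := hf
  exact ⟨W, hW, fun y hy => hf y (h hy)⟩

theorem JointlyLSCOn.congr {S : Set (X × ProbabilityMeasure X)}
    {f g : ProbabilityMeasure X → X → ℝ≥0∞} (hf : JointlyLSCOn 𝒳 S f)
    (h : ∀ p ∈ S, g p.2 p.1 = f p.2 p.1) : JointlyLSCOn 𝒳 S g := by
  obtain ⟨W, hW, hf⟩ := hf
  exact ⟨W, hW, fun y hy q => by simpa only [h y hy] using hf y hy q⟩

variable [BorelSpace X]

/-- A certificate rules out activity of every code whose hat is not in `H`, so the active hats form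
a sublist of `H` in content, and the bounds for `H` apply. -/
theorem Certifies.isSmallAt {n : ℕ} {M : List SubCode} (h : Certifies E n M)
    (hμ : μ ∈ 𝒳.measBasis M) : IsSmallAt 𝒳 E n μ := by
  obtain ⟨a, ha, h⟩ := h
  refine (Finset.sum_le_sum fun k hk => ?_).trans_lt (sum_two_pow_mul_lt ha)
  obtain ⟨H, hH, hE⟩ := h k (by simpa using hk)
  refine mul_le_mul_of_nonneg_left ?_ (by positivity)
  refine (integral_maxHat_mono 𝒳 (L' := H) ?_ μ).trans
    ((mem_measSubbasis_false 𝒳).1 (hμ _ hH)).le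
  intro c hc
  obtain ⟨e, he, ⟨hk, hact⟩, rfl⟩ := (mem_activeHats 𝒳).1 hc
  rcases hE e he with h | h | ⟨c, hce, hcM⟩
  · exact absurd hk h
  · exact h
  · exact absurd (hμ _ hcM) (hact c hce)

theorem measurable_stage (n : ℕ) (μ : ProbabilityMeasure X) : Measurable (stage 𝒳 E n μ) := by
  unfold stage
  exact Finset.measurable_fun_sum _ fun k _ =>
    ((continuous_maxHat 𝒳 _).measurable.ennreal_ofReal).const_mul _

theorem lintegral_stage (n : ℕ) (μ : ProbabilityMeasure X) :
    ∫⁻ x, stage 𝒳 E n μ x ∂(μ : Measure X) = ENNReal.ofReal (∑ k ∈ Finset.range n,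
      2 ^ k * ∫ x, 𝒳.maxHat (activeHats 𝒳 (E n) k n μ) x ∂(μ : Measure X)) := by
  unfold stage
  rw [lintegral_finsetSum _ fun k _ =>
    ((continuous_maxHat 𝒳 _).measurable.ennreal_ofReal).const_mul _,
    ENNReal.ofReal_sum_of_nonneg fun k _ => mul_nonneg (by positivity)
      (integral_nonneg fun x => maxHat_nonneg 𝒳 _ x)]
  refine Finset.sum_congr rfl fun k _ => ?_
  rw [lintegral_const_mul _ (continuous_maxHat 𝒳 _).measurable.ennreal_ofReal, lintegral_maxHat,
    ENNReal.ofReal_mul (by positivity), ENNReal.ofReal_pow (by norm_num)]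
  norm_num

/-- A level is granted only through a stage certified at `μ`, and the hat responsible for it already
equals 1 at `x` in that stage; a single summand of the stage therefore pays for it. -/
theorem trim_le (μ : ProbabilityMeasure X) (x : X) :
    trim 𝒳 E μ x ≤ 1 + ⨆ n : {n // IsSmallAt 𝒳 E n μ}, stage 𝒳 E n μ x := by
  refine max_le le_self_add (le_add_left (iSup₂_le fun k hk => ?_))
  obtain ⟨⟨b, M⟩, ⟨n, hkn, hcert, e, he, hek, hb, hr, hV⟩, hxb, hμ⟩ := hk
  refine le_trans ?_ (le_iSup (fun n : {n // IsSmallAt 𝒳 E n μ} => stage 𝒳 E n μ x)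
    ⟨n, hcert.isSmallAt hμ⟩)
  refine le_trans ?_ (Finset.single_le_sum (f := fun k => 2 ^ k * ENNReal.ofReal
    (𝒳.maxHat (activeHats 𝒳 (E n) k n μ) x)) (fun _ _ => zero_le) (Finset.mem_range.2 hkn))
  refine le_mul_of_one_le_right zero_le (ENNReal.one_le_ofReal.2 ?_)
  -- The granted ball is concentric with the enumerated one and smaller in radius by more than `1 /
  -- (n + 1)`.
  have h1 : 𝒳.hatOf (innerHat e.1.1 n) x = 1 := by
    apply hatOf_innerHat_eq_one
    dsimp only at hb hr hxb
    rw [ComputableMetric.ball, Metric.mem_ball, hb] at hxb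
    rw [ratOf_ratAdd, ← posRatOf_eq_ratOf, ← posRatOf_eq_ratOf e.1.1.2] at hr
    linarith
  rw [← h1]
  exact hatOf_le_maxHat 𝒳 ((mem_activeHats 𝒳).2
    ⟨e, he, ⟨hek, fun c hc => notMem_flip_of_mem 𝒳 (hμ _ (hV c hc))⟩, rfl⟩) x

theorem lintegral_trim_le (hE : ∀ m n, m ≤ n → E m ⊆ E n) (μ : ProbabilityMeasure X) :
    ∫⁻ x, trim 𝒳 E μ x ∂(μ : Measure X) ≤ 4 := by
  refine (lintegral_mono (trim_le μ)).trans ?_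
  rw [lintegral_add_left measurable_const,
    lintegral_iSup_directed (fun n => (measurable_stage _ μ).aemeasurable)]
  · rw [lintegral_const, measure_univ, mul_one]
    -- The constant 1 contributes 1, and monotone convergence over the stages small at `μ`
    -- contributes at most 3.
    have : (4 : ℝ≥0∞) = 1 + 3 := by norm_num
    rw [this]
    gcongr
    refine iSup_le fun ⟨n, hn⟩ => ?_
    rw [lintegral_stage]
    exact ENNReal.ofReal_le_of_le_toReal (by simpa using le_of_lt hn)
  · intro m n
    rcases le_total m.1 n.1 with h | h
    · exact ⟨n, fun x => stage_mono hE h μ x, le_rfl⟩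
    · exact ⟨m, le_rfl, fun x => stage_mono hE h μ x⟩

theorem isUniformTest_trim (hE : Computable E) (hE' : ∀ m n, m ≤ n → E m ⊆ E n) :
    IsUniformTest 𝒳 fun μ x => trim 𝒳 E μ x / 4 := by
  refine ⟨jointlyLSCOn_trim hE, fun μ => ⟨?_, ?_⟩⟩
  · refine ((jointlyLSCOn_trim hE).mono (subset_univ _)).congr ?_
    rintro ⟨x, ν⟩ ⟨-, rfl⟩
    rfl
  · simp only [div_eq_mul_inv]
    rw [lintegral_mul_const' _ _ (by simp), ← div_eq_mul_inv]
    exact ENNReal.div_le_of_le_mul (by simpa using lintegral_trim_le hE' μ)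

theorem sum_two_pow_le (n : ℕ) : ∑ k ∈ Finset.range n, (2 : ℝ≥0∞) ^ k ≤ 2 ^ n := by
  induction n with
  | zero => simp
  | succ n ih =>
    rw [Finset.sum_range_succ, pow_succ, mul_two]
    gcongr

-- The sum is geometric: if `2 ^ n < v` is its largest term, the earlier terms add up to at most `2
-- ^ n`.
open Classical in
theorem sum_two_pow_mul_ite_le (n : ℕ) (v : ℝ≥0∞) :
    ∑ k ∈ Finset.range n, 2 ^ k * (if 2 ^ k < v then 1 else 0) ≤ 2 * v := by
  induction n with
  | zero => simp
  | succ n ih =>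
    rw [Finset.sum_range_succ]
    split_ifs with h
    · refine (add_le_add_left (Finset.sum_le_sum (g := fun k => 2 ^ k) fun k _ => ?_) _).trans ?_
      · split_ifs <;> simp
      · rw [mul_one, two_mul]
        exact add_le_add ((sum_two_pow_le n).trans h.le) h.le
    · simpa using ih

/-- If `v` exceeds `2 ^ k` only when `t` is at least `2 ^ k`, then `v` is at most `2 * t`. -/
theorem le_two_mul_of_forall_two_pow {t v : ℝ≥0∞} (ht : 1 ≤ t)
    (h : ∀ k : ℕ, 2 ^ k < v → 2 ^ k ≤ t) : v ≤ 2 * t := by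
  rcases eq_or_ne t ∞ with rfl | htop
  · simp
  lift t to ℝ≥0 using htop
  -- With `2 ^ n ≤ t < 2 ^ (n + 1)`, the assumption `2 * t < v` gives `2 ^ (n + 1) < v`, hence `2 ^
  -- (n + 1) ≤ t`, a contradiction.
  obtain ⟨n, h1, h2⟩ := exists_nat_pow_near (x := t) (y := 2) (by exact_mod_cast ht) one_lt_two
  by_contra! hlt
  have h3 : ((2 : ℝ≥0∞) ^ (n + 1)) ≤ 2 * t := by
    rw [pow_succ, mul_comm]
    gcongr
    exact_mod_cast h1
  have h4 := h (n + 1) (h3.trans_lt hlt)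
  exact absurd h2 (not_lt.2 (by exact_mod_cast h4))

theorem nnratOf_two_pow (k : ℕ) : (nnratOf (2 ^ k, 0) : ℝ≥0∞) = 2 ^ k := by
  simp [nnratOf]

/-- A lower semicomputable function on `X × C` that is a `μ`-test for each `μ ∈ C` is dominated on
`X × C` by a uniform test. -/
theorem exists_isUniformTest_forall_le {C : Set (ProbabilityMeasure X)}
    {φ : ProbabilityMeasure X → X → ℝ≥0∞} (hφ : JointlyLSCOn 𝒳 (univ ×ˢ C) φ)
    (hint : ∀ μ ∈ C, ∫⁻ x, φ μ x ∂(μ : Measure X) ≤ 1) :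
    ∃ f, IsUniformTest 𝒳 f ∧ ∀ μ ∈ C, ∀ x, φ μ x ≤ 8 * f μ x := by
  classical
  obtain ⟨W, hW, hφ⟩ := hφ
  obtain ⟨E, hE, hmono, hmem⟩ := REPred.exists_list (hW.comp
    (f := fun e : LevelCode => (e.1, (2 ^ e.2, 0))) (by fun_prop))
  refine ⟨_, isUniformTest_trim hE hmono, fun μ hμ x => ?_⟩
  have hlt : ∀ x k, 2 ^ k < φ μ x ↔
      ∃ i, W (i, (2 ^ k, 0)) ∧ (x, μ) ∈ prodBasis 𝒳.ball 𝒳.measBasis i := fun x k => by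
    rw [← nnratOf_two_pow]
    exact hφ (x, μ) ⟨trivial, hμ⟩ _
  -- On `C` no stage is rejected: active hats vanish where `φ μ x ≤ 2 ^ k`, so each stage is at most
  -- `2 * φ μ x` and has integral at most 2. The strict room below 3 is what lets a certificate
  -- exist.
  have hsmall : ∀ n, IsSmallAt 𝒳 E n μ := by
    intro n
    have h1 : ∀ x, stage 𝒳 E n μ x ≤ 2 * φ μ x := by
      intro x
      refine le_trans (Finset.sum_le_sum fun k _ => ?_) (sum_two_pow_mul_ite_le n (φ μ x))
      gcongr
      split_ifs with h
      · exact ENNReal.ofReal_le_one.2 (maxHat_le_one _ _ _)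
      · refine (ENNReal.ofReal_eq_zero.2 ((maxHat_le_iff 𝒳 _ _ _).2 ⟨le_rfl, fun c hc => ?_⟩)).le
        obtain ⟨e, he, ⟨rfl, hact⟩, rfl⟩ := (mem_activeHats 𝒳).1 hc
        refine (hatOf_innerHat_eq_zero 𝒳 n fun hx => h ((hlt x e.2).2
          ⟨e.1, (hmem e).2 ⟨n, he⟩, hx, fun c hc => ?_⟩)).le
        exact mem_of_notMem_flip_shrink 𝒳 (hact c hc)
    have h2 : ∫⁻ x, stage 𝒳 E n μ x ∂(μ : Measure X) ≤ ENNReal.ofReal 2 := by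
      refine (lintegral_mono h1).trans ?_
      rw [lintegral_const_mul' _ _ (by simp)]
      simpa using mul_le_mul_right (hint μ hμ) 2
    rw [lintegral_stage, ENNReal.ofReal_le_ofReal_iff zero_le_two] at h2
    exact h2.trans_lt (by norm_num)
  have htrim : φ μ x ≤ 2 * trim 𝒳 E μ x := by
    refine le_two_mul_of_forall_two_pow (le_max_left _ _) fun k hk => ?_
    obtain ⟨i, hi, hx, hV⟩ := (hlt x k).1 hk
    refine le_max_of_le_right (le_iSup₂_of_le k ?_ le_rfl)
    obtain ⟨n₀, hn₀⟩ := (hmem (i, k)).1 hi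
    obtain ⟨n₁, hn₁⟩ := exists_forall_mem_shrink_list 𝒳 hV
    have hx' : 0 < posRatOf i.1.2 - dist x (𝒳.α i.1.1) := sub_pos.2 hx
    obtain ⟨n₂, hn₂⟩ := exists_forall_one_div_lt hx'
    -- At this stage the code is enumerated, `μ` lies in the shrunken conditions, `x` is deep enough
    -- in the ball, and level `k` is among those summed.
    set n := max (max n₀ n₁) (max n₂ (k + 1))
    have h0 : n₀ ≤ n := by omega
    have h1 : n₁ ≤ n := by omega
    have h2 : n₂ ≤ n := by omega
    have hkn : k < n := by omega
    obtain ⟨M, hM, hMμ⟩ := (hsmall n).exists_certifies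
    obtain ⟨r, hr1, hr2⟩ := exists_posRatOf_btwn (dist_nonneg (x := x) (y := 𝒳.α i.1.1))
      (lt_sub_comm.1 (hn₂ n h2))
    refine ⟨((i.1.1, r), M ++ i.2.map (shrink n)), ⟨n, hkn, hM.mono (List.subset_append_left _ _),
      (i, k), hmono _ _ h0 hn₀, rfl, rfl, ?_, fun c hc =>
        List.mem_append_right _ (List.mem_map_of_mem hc)⟩, hr1, ?_⟩
    · rw [ratOf_ratAdd, ← posRatOf_eq_ratOf r, ← posRatOf_eq_ratOf i.1.2]
      linarith
    · refine (mem_measBasis_append 𝒳).2 ⟨hMμ, fun c hc => ?_⟩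
      obtain ⟨c', hc', rfl⟩ := List.mem_map.1 hc
      exact hn₁ n h1 c' hc'
  calc φ μ x ≤ 2 * trim 𝒳 E μ x := htrim
    -- The 8 is the 2 lost by passing to powers of two, times the normalisation 4.
    _ = 8 * (trim 𝒳 E μ x / 4) := by
      rw [ENNReal.div_eq_inv_mul, ← mul_assoc]
      congr 1
      rw [← div_eq_mul_inv, ENNReal.eq_div_iff (by simp) (by simp)]
      norm_num

end

end AlgRandom

/-! ### Tests with respect to an effectively compact class -/

namespace AlgRandom

variable {X : Type*} [MetricSpace X] [MeasurableSpace X] {𝒳 : ComputableMetric X}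

theorem LowerSemicomputable.jointlyLSCOn {f : X → ℝ≥0∞} (hf : LowerSemicomputable 𝒳.ball f) :
    JointlyLSCOn 𝒳 univ fun _ => f := by
  obtain ⟨W, hW, hf⟩ := hf
  refine ⟨fun i => W (i.1.1, i.2), hW.comp (by fun_prop), fun y _ q => (hf y.1 trivial q).trans ?_⟩
  constructor
  · rintro ⟨b, hb, hy⟩
    exact ⟨(b, []), hb, hy, mem_measBasis_nil 𝒳 y.2⟩
  · rintro ⟨i, hi, hy⟩
    exact ⟨i.1, hi, hy.1⟩

theorem nnratOf_lt_div_two_iff (q : ℕ × ℕ) (v : ℝ≥0∞) :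
    (nnratOf q : ℝ≥0∞) < v / 2 ↔ (nnratOf (q.1 * 2, q.2) : ℝ≥0∞) < v := by
  have h : nnratOf (q.1 * 2, q.2) = nnratOf q * 2 := by
    simp only [nnratOf]
    push_cast
    ring
  rw [ENNReal.lt_div_iff_mul_lt (by simp) (by simp), h]
  push_cast
  rfl

theorem JointlyLSCOn.max_div_two {S : Set (X × ProbabilityMeasure X)}
    {f g : ProbabilityMeasure X → X → ℝ≥0∞} (hf : JointlyLSCOn 𝒳 S f) (hg : JointlyLSCOn 𝒳 S g) :
    JointlyLSCOn 𝒳 S fun μ x => max (f μ x) (g μ x) / 2 := by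
  obtain ⟨W, hW, hf⟩ := hf
  obtain ⟨W', hW', hg⟩ := hg
  refine ⟨fun i => W (i.1, (i.2.1 * 2, i.2.2)) ∨ W' (i.1, (i.2.1 * 2, i.2.2)),
    .or (hW.comp (by fun_prop)) (hW'.comp (by fun_prop)), fun y hy q => ?_⟩
  rw [nnratOf_lt_div_two_iff, lt_max_iff, hf y hy, hg y hy, ← exists_or]
  simp only [or_and_right]

/-- For fixed `μ` the conditions on measures merely select balls, so superlevel sets at rational
levels are open. -/
theorem IsMeasureTest.measurable [OpensMeasurableSpace X] {μ : ProbabilityMeasure X} {f : X → ℝ≥0∞}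
    (hf : IsMeasureTest 𝒳 μ f) : Measurable f := by
  obtain ⟨⟨W, -, hf⟩, -⟩ := hf
  have h : ∀ q, IsOpen {x | (nnratOf q : ℝ≥0∞) < f x} := fun q => by
    have : {x | (nnratOf q : ℝ≥0∞) < f x} =
        ⋃ i ∈ {i | W (i, q) ∧ μ ∈ 𝒳.measBasis i.2}, 𝒳.ball i.1 := by
      ext x
      simp only [mem_iUnion₂]
      refine (hf (x, μ) ⟨trivial, rfl⟩ q).trans ⟨?_, ?_⟩
      · rintro ⟨i, hi, hx, hμ⟩
        exact ⟨i, ⟨hi, hμ⟩, hx⟩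
      · rintro ⟨i, ⟨hi, hμ⟩, hx⟩
        exact ⟨i, hi, hx, hμ⟩
    rw [this]
    exact isOpen_biUnion fun i _ => Metric.isOpen_ball
  refine measurable_of_Ioi fun a => ?_
  have : f ⁻¹' Ioi a = ⋃ q ∈ {q | a < (nnratOf q : ℝ≥0∞)}, {x | (nnratOf q : ℝ≥0∞) < f x} := by
    ext x
    simp only [mem_iUnion₂]
    constructor
    · intro hx
      obtain ⟨q, h1, h2⟩ := exists_nnratOf_btwn hx
      exact ⟨q, h1, h2⟩
    · rintro ⟨q, h1, h2⟩
      exact lt_trans (b := (nnratOf q : ℝ≥0∞)) h1 h2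
  rw [this]
  exact (isOpen_biUnion fun q _ => h q).measurableSet

theorem lintegral_max_div_two_le {X : Type*} [MeasurableSpace X] {μ : Measure X}
    {f g : X → ℝ≥0∞} (hf : Measurable f)
    (h1 : ∫⁻ x, f x ∂μ ≤ 1) (h2 : ∫⁻ x, g x ∂μ ≤ 1) : ∫⁻ x, max (f x) (g x) / 2 ∂μ ≤ 1 := by
  simp only [div_eq_mul_inv]
  rw [lintegral_mul_const' _ _ (by simp), ← div_eq_mul_inv]
  refine ENNReal.div_le_of_le_mul ?_
  calc ∫⁻ x, max (f x) (g x) ∂μ ≤ ∫⁻ x, f x + g x ∂μ :=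
        lintegral_mono fun x => max_le le_self_add le_add_self
    _ = ∫⁻ x, f x ∂μ + ∫⁻ x, g x ∂μ := lintegral_add_left hf _
    _ ≤ 1 * 2 := by
      rw [one_mul, ← one_add_one_eq_two]
      exact add_le_add h1 h2

/-- The code of the difference of two positive rationals. -/
def posRatDiff (p q : ℕ × ℕ) : ℕ × ℕ × ℕ :=
  ((p.1 + 1) * (q.2 + 1), (q.1 + 1) * (p.2 + 1), (p.2 + 1) * q.2 + p.2)

theorem ratOf_posRatDiff (p q : ℕ × ℕ) : ratOf (posRatDiff p q) = posRatOf p - posRatOf q := by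
  have h1 : ((p.2 : ℝ) + 1) ≠ 0 := by positivity
  have h2 : ((q.2 : ℝ) + 1) ≠ 0 := by positivity
  have h3 : ((p.2 : ℝ) + 1) * q.2 + p.2 + 1 = (p.2 + 1) * (q.2 + 1) := by ring
  simp only [ratOf, posRatOf, posRatDiff]
  push_cast
  rw [h3]
  field_simp

/-- Formal inclusion of canonical balls is recursively enumerable. -/
theorem rePred_dist_add_lt {X : Type*} [MetricSpace X] (𝒳 : ComputableMetric X) :
    REPred fun b : (ℕ × ℕ × ℕ) × (ℕ × ℕ × ℕ) =>
      dist (𝒳.α b.1.1) (𝒳.α b.2.1) + posRatOf b.1.2 < posRatOf b.2.2 := by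
  obtain ⟨g, hg, hdist⟩ := 𝒳.computable_dist
  have h : REPred fun b : (ℕ × ℕ × ℕ) × (ℕ × ℕ × ℕ) => ∃ n : ℕ,
      ratOf (ratAdd n (g (b.1.1, b.2.1, n))) < ratOf (posRatDiff b.2.2 b.1.2) := by
    refine .exists' (rePred_ratOf_lt (by fun_prop) ?_)
    unfold posRatDiff
    fun_prop
  refine h.of_eq fun b => ?_
  simp only [ratOf_ratAdd, ratOf_posRatDiff]
  constructor
  · rintro ⟨n, hn⟩
    have := (abs_le.1 (hdist b.1.1 b.2.1 n)).2
    linarith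
  · intro hlt
    obtain ⟨N, hN⟩ := exists_forall_one_div_lt (δ := (posRatOf b.2.2 - posRatOf b.1.2 -
      dist (𝒳.α b.1.1) (𝒳.α b.2.1)) / 2) (by linarith)
    refine ⟨N, ?_⟩
    have h1 := hN N le_rfl
    have h2 := (abs_le.1 (hdist b.1.1 b.2.1 N)).1
    linarith

/-- Finitely many canonical balls containing `x` formally contain a common canonical ball
around `x`. -/
theorem exists_ball_forall_dist_add_lt {X : Type*} [MetricSpace X] (𝒳 : ComputableMetric X) (x : X)
    (L : List (ℕ × ℕ × ℕ)) (hL : ∀ b ∈ L, x ∈ 𝒳.ball b) : ∃ b, x ∈ 𝒳.ball b ∧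
      ∀ b' ∈ L, dist (𝒳.α b.1) (𝒳.α b'.1) + posRatOf b.2 < posRatOf b'.2 := by
  have hδ : ∃ δ > 0, ∀ b' ∈ L, dist x (𝒳.α b'.1) + δ ≤ posRatOf b'.2 := by
    induction L with
    | nil => exact ⟨1, one_pos, by simp⟩
    | cons b L ih =>
      obtain ⟨δ, hδ, h⟩ := ih fun b' hb' => hL b' (by simp [hb'])
      have hb : dist x (𝒳.α b.1) < posRatOf b.2 := hL b (by simp)
      refine ⟨min δ (posRatOf b.2 - dist x (𝒳.α b.1)), lt_min hδ (by linarith), fun b' hb' => ?_⟩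
      rcases List.mem_cons.1 hb' with rfl | hb'
      · linarith [min_le_right δ (posRatOf b'.2 - dist x (𝒳.α b'.1))]
      · linarith [min_le_left δ (posRatOf b.2 - dist x (𝒳.α b.1)), h b' hb']
  obtain ⟨δ, hδ, h⟩ := hδ
  obtain ⟨b, hb, hlt⟩ := exists_ball_mem 𝒳 x hδ
  refine ⟨b, hb, fun b' hb' => ?_⟩
  have h1 := h b' hb'
  have h2 := dist_triangle_left (𝒳.α b.1) (𝒳.α b'.1) x
  linarith

/-- The infimum of a lower semicomputable function over an effectively compact class is lower
semicomputable. -/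
theorem lowerSemicomputable_iInf [BorelSpace X] {C : Set (ProbabilityMeasure X)}
    (hC : EffectivelyCompact 𝒳.measBasis C) {f : ProbabilityMeasure X → X → ℝ≥0∞}
    (hf : JointlyLSCOn 𝒳 (univ ×ˢ C) f) :
    LowerSemicomputable 𝒳.ball fun x => ⨅ μ ∈ C, f μ x := by
  obtain ⟨W, hW, hf⟩ := hf
  -- Strict bounds at each `μ` give only a weak bound on the infimum, hence a rational `r` strictly
  -- above the level. The ball must be formally included in every first factor, and the second
  -- factors must cover `C`.
  refine ⟨fun b => ∃ r : ℕ × ℕ, nnratOf b.2 < nnratOf r ∧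
    ∃ L : List ((ℕ × ℕ × ℕ) × List SubCode), (C ⊆ ⋃ v ∈ L.map Prod.snd, 𝒳.measBasis v) ∧
      ∀ i ∈ L, W (i, r) ∧ dist (𝒳.α b.1.1) (𝒳.α i.1.1) + posRatOf b.1.2 < posRatOf i.1.2, ?_, ?_⟩
  · refine .exists' (.and (rePred_nnratOf_lt (by fun_prop) (by fun_prop)) (.exists'
      (.and (hC.2.comp ?_) ?_)))
    · exact (Primrec.list_map .snd (Primrec.snd.comp₂ .right)).to_comp
    · refine .forall_mem (by fun_prop) (.and (hW.comp (by fun_prop)) ?_)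
      exact (rePred_dist_add_lt 𝒳).comp (f := fun x : ((((ℕ × ℕ × ℕ) × ℕ × ℕ) × ℕ × ℕ) ×
        List ((ℕ × ℕ × ℕ) × List SubCode)) × (ℕ × ℕ × ℕ) × List SubCode =>
        (x.1.1.1.1, x.2.1)) (by fun_prop)
  · intro x _ q
    constructor
    · intro hq
      obtain ⟨r, hqr, hr⟩ := exists_nnratOf_btwn hq
      have hcover : ∀ μ ∈ C, ∃ i, W (i, r) ∧ (x, μ) ∈ prodBasis 𝒳.ball 𝒳.measBasis i :=
        fun μ hμ => (hf (x, μ) ⟨trivial, hμ⟩ r).1 (hr.trans_le (iInf₂_le μ hμ))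
      -- Only codes whose ball contains `x` index the cover, so one canonical ball around `x` fits
      -- formally inside all the finitely many balls selected.
      obtain ⟨T, hT⟩ := hC.1.elim_finite_subcover
        (fun i : {i // W (i, r) ∧ x ∈ 𝒳.ball i.1} => 𝒳.measBasis i.1.2)
        (fun i => isOpen_measBasis 𝒳 _) fun μ hμ => by
          obtain ⟨i, hi, hx, hV⟩ := hcover μ hμ
          exact mem_iUnion.2 ⟨⟨i, hi, hx⟩, hV⟩
      obtain ⟨b, hxb, hb⟩ := exists_ball_forall_dist_add_lt 𝒳 x (T.toList.map fun i => i.1.1)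
        fun b hb => by
          obtain ⟨i, -, rfl⟩ := List.mem_map.1 hb
          exact i.2.2
      refine ⟨b, ⟨r, by exact_mod_cast hqr, T.toList.map (fun i => i.1), ?_, ?_⟩, hxb⟩
      · intro μ hμ
        obtain ⟨i, hi, hV⟩ := mem_iUnion₂.1 (hT hμ)
        exact mem_iUnion₂.2 ⟨i.1.2, List.mem_map_of_mem
          (List.mem_map.2 ⟨i, Finset.mem_toList.2 hi, rfl⟩), hV⟩
      · intro j hj
        obtain ⟨i, hi, rfl⟩ := List.mem_map.1 hj
        exact ⟨i.2.1, hb _ (List.mem_map.2 ⟨i, hi, rfl⟩)⟩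
    · rintro ⟨b, ⟨r, hqr, L, hCV, hL⟩, hxb⟩
      refine lt_of_lt_of_le (b := (nnratOf r : ℝ≥0∞)) (by exact_mod_cast hqr)
        (le_iInf₂ fun μ hμ => ?_)
      obtain ⟨v, hv, hμv⟩ := mem_iUnion₂.1 (hCV hμ)
      obtain ⟨i, hi, rfl⟩ := List.mem_map.1 hv
      refine ((hf (x, μ) ⟨trivial, hμ⟩ r).2 ⟨i, (hL i hi).1, ?_, hμv⟩).le
      have h1 : dist x (𝒳.α b.1) < posRatOf b.2 := hxb
      have h2 := (hL i hi).2
      have h3 := dist_triangle x (𝒳.α b.1) (𝒳.α i.1.1)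
      exact Metric.mem_ball.2 (by linarith)

end AlgRandom

/-! ### The characterization of randomness by class tests and separating tests. -/

theorem mainTheorem9 {X : Type*} [MetricSpace X] [CompleteSpace X] [MeasurableSpace X]
    [BorelSpace X] (𝒳 : AlgRandom.ComputableMetric X)
    (C : Set (ProbabilityMeasure X)) (hC : AlgRandom.EffectivelyCompact 𝒳.measBasis C)
    (t : ProbabilityMeasure X → X → ℝ≥0∞) (ht : AlgRandom.IsUniversalUniformTest 𝒳 t)
    (tC : X → ℝ≥0∞) (htC : AlgRandom.IsUniversalClassTest 𝒳 C tC)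
    (s : ProbabilityMeasure X → X → ℝ≥0∞) (hs : AlgRandom.IsSeparatingTest 𝒳 C s) :
    (∃ c : ℝ≥0, 0 < c ∧ ∀ μ ∈ C, ∀ x : X,
      t μ x ≤ c * max (tC x) (s μ x) ∧ max (tC x) (s μ x) ≤ c * t μ x) ∧
    ∀ μ ∈ C, ∀ x : X, t μ x < ∞ ↔ tC x < ∞ ∧ s μ x < ∞ := by
  obtain ⟨⟨ht1, ht2⟩, ht3⟩ := ht
  obtain ⟨⟨htC1, htC2⟩, htC3⟩ := htC
  obtain ⟨hs1, hs2, hs3⟩ := hs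
  have hdouble : ∀ v : ℝ≥0∞, v = 2 * (v / 2) := fun v =>
    (ENNReal.mul_div_cancel (by simp) (by simp)).symm
  obtain ⟨a, ha, hmax⟩ : ∃ a : ℝ≥0, 0 < a ∧ ∀ μ ∈ C, ∀ x, max (tC x) (s μ x) ≤ a * t μ x := by
    obtain ⟨f, hf, hle⟩ := AlgRandom.exists_isUniformTest_forall_le
      ((htC1.jointlyLSCOn.mono (subset_univ _)).max_div_two hs1) fun μ hμ => by
        simp only [max_comm (tC _)]
        exact AlgRandom.lintegral_max_div_two_le (hs2 μ hμ).measurable (hs2 μ hμ).2 (htC2 μ hμ)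
    obtain ⟨c, hc, hfc⟩ := ht3 f hf
    -- The factors come from halving the maximum, from trimming, and from universality of `t`.
    refine ⟨2 * (8 * c), by positivity, fun μ hμ x => ?_⟩
    rw [hdouble (max (tC x) (s μ x))]
    push_cast
    rw [mul_assoc, mul_assoc]
    gcongr
    exact (hle μ hμ x).trans (by gcongr; exact hfc μ x)
  obtain ⟨b, hb, htle⟩ : ∃ b : ℝ≥0, 0 < b ∧ ∀ μ ∈ C, ∀ x, t μ x ≤ b * max (tC x) (s μ x) := by
    -- For each `μ ∈ C` the infimum lies below its own term at `μ`, whose integral is at most 1.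
    obtain ⟨c, hc, hle⟩ := htC3 (fun x => ⨅ μ ∈ C, max (t μ x) (s μ x) / 2)
      ⟨AlgRandom.lowerSemicomputable_iInf hC ((ht1.mono (subset_univ _)).max_div_two hs1),
        fun μ hμ => (lintegral_mono fun x => iInf₂_le μ hμ).trans
          (AlgRandom.lintegral_max_div_two_le (ht2 μ).measurable (ht2 μ).2 (hs2 μ hμ).2)⟩
    refine ⟨2 * c, by positivity, fun μ hμ x => ?_⟩
    by_cases hsx : s μ x = ∞
    · rw [hsx, max_eq_right le_top, ENNReal.mul_top (by simpa using hc.ne')]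
      exact le_top
    -- Since `s μ x` is finite, separation forces `s ν x = ∞` for every other `ν ∈ C`, so the
    -- infimum is attained at `μ`.
    · have h1 : max (t μ x) (s μ x) / 2 ≤ ⨅ ν ∈ C, max (t ν x) (s ν x) / 2 := by
        refine le_iInf₂ fun ν hν => ?_
        rcases eq_or_ne μ ν with rfl | hne
        · exact le_rfl
        · have h2 : s ν x = ∞ := (max_eq_top.1 (hs3 μ hμ ν hν hne x)).resolve_left hsx
          rw [h2, max_eq_right le_top, ENNReal.top_div_of_ne_top (by simp)]
          exact le_top
      calc t μ x ≤ max (t μ x) (s μ x) := le_max_left _ _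
        _ = 2 * (max (t μ x) (s μ x) / 2) := hdouble _
        _ ≤ 2 * (c * tC x) := by gcongr; exact h1.trans (hle x)
        _ ≤ (2 * c : ℝ≥0) * max (tC x) (s μ x) := by
          push_cast
          rw [mul_assoc]
          gcongr
          exact le_max_left _ _
  refine ⟨⟨max a b, lt_max_of_lt_left ha, fun μ hμ x => ⟨(htle μ hμ x).trans ?_,
    (hmax μ hμ x).trans ?_⟩⟩, fun μ hμ x => ?_⟩
  · gcongr
    exact le_max_right _ _
  · gcongr
    exact le_max_left _ _
  · rw [← max_lt_iff]
    exact ⟨fun h => (hmax μ hμ x).trans_lt (ENNReal.mul_lt_top ENNReal.coe_lt_top h),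
      fun h => (htle μ hμ x).trans_lt (ENNReal.mul_lt_top ENNReal.coe_lt_top h)⟩
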